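/- Let $\mathbf k$ be a field of characteristic zero, let $n\ge 2$ be an integer and let $d\in\mathbb Z$. Work with (symmetric, unital) operads in graded $\mathbf k$-vector spaces, with partial compositions $\circ_i$ subject to the Koszul sign rule; in particular $(x\circ_i y)\circ_{j+b-1}z=(-1)^{|y||z|}(x\circ_j z)\circ_i y$ for $i<j$, where $b$ is the arity of $y$. Let $\Gamma(\mu)$ be the free operad on one generator $\mu$ of arity $n$ and degree $d$ without symmetry (that is, on the $\Sigma$-module which is the regular representation $\mathbf k[\Sigma_n]$ in arity $n$ and degree $d$ and zero elsewhere), and let $$t\mathcal{A}ss^n_d:=\Gamma(\mu)/\bigl(\mu\circ_i\mu-\mu\circ_j\mu,\ 1\le i,j\le n\bigr)$$ be its quotient by the operadic ideal generated by the indicated elements. For a graded operad $\mathcal P$ whose components $\mathcal P(a)$ have finite total dimension, let $$g_{\mathcal P}(t):=\sum_{a\ge1}\frac{1}{a!}\,\chi(\mathcal P(a))\,t^a\in\mathbb Q[[t]],\qquad \chi(\mathcal P(a)):=\sum_{i\in\mathbb Z}(-1)^i\dim_{\mathbf k}\mathcal P_i(a),$$ be its Poincaré series. Then every component $t\mathcal{A}ss^n_d(a)$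 has finite total dimension, and $$g_{t\mathcal{A}ss^n_d}(t)=\begin{cases}\dfrac{t}{1-t^{n-1}} & \text{if } d \text{ is even},\\[2ex] t-t^n+t^{2n-1} & \text{if } d\text{ is odd}.\end{cases}$$ Moreover, if $d$ is odd, then $t\mathcal{A}ss^n_d(k(n-1)+1)=0$ for all $k\ge 3$. -/

import Mathlib

universe u v

namespace NAry

/-- The Koszul sign `(-1)^(p q)`. -/
def koszulSign (k : Type u) [Field k] (p q : ℤ) : k :=
  (((p * q).negOnePow : ℤˣ) : ℤ)

/-! ### Positions of inputs in a partial composition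

Inputs are numbered from `0`. When an operation with `b` inputs is plugged into the input `i` of
an operation with `a` inputs, the result has `c = a + b - 1` inputs. -/

/-- The position, after the insertion of `b` inputs in place of `i`, of the `j`-th new input. -/
def inner {a b c : ℕ} (h : a + b = c + 1) (i : Fin a) (j : Fin b) : Fin c :=
  ⟨i + j, by omega⟩

/-- The position, after the insertion of `b` inputs in place of `i`, of the old input `l ≠ i`. -/
def outer {a b c : ℕ} (h : a + b = c + 1) (i : Fin a) (l : {l : Fin a // l ≠ i}) : Fin c :=
  if hl : l.1 < i then ⟨l.1, by omega⟩
  else ⟨l.1 + b - 1, by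
    have h1 : (l.1 : ℕ) ≠ i := fun e => l.2 (Fin.ext e)
    have h2 : ¬ ((l.1 : ℕ) < i) := hl
    omega⟩

/-- The inputs of a partial composition: the remaining old ones and the new ones. -/
def slots {a b c : ℕ} (h : a + b = c + 1) (i : Fin a) :
    {l : Fin a // l ≠ i} ⊕ Fin b ≃ Fin c where
  toFun := Sum.elim (outer h i) (inner h i)
  invFun x :=
    if h1 : (x : ℕ) < i then
      Sum.inl ⟨⟨x, by omega⟩, fun e => by have := congrArg Fin.val e; simp at this; omega⟩
    else if h2 : (x : ℕ) < i + b then Sum.inr ⟨x - i, by omega⟩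
    else Sum.inl ⟨⟨x + 1 - b, by omega⟩, fun e => by
      have := congrArg Fin.val e; simp at this; omega⟩
  left_inv s := by
    rcases s with ⟨l, hl⟩ | j
    · have h1 : (l : ℕ) ≠ i := fun e => hl (Fin.ext e)
      by_cases h2 : l < i
      · have h3 : (l : ℕ) < i := h2
        simp [outer, h2]
      · have h3 : ¬ (l : ℕ) < i := h2
        have h4 : ¬ (l : ℕ) + b - 1 < i := by omega
        have h5 : ¬ (l : ℕ) + b - 1 < i + b := by omega
        simp only [Sum.elim_inl, outer, h2, dif_neg, not_false_eq_true, h4, h5]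
        congr 2
        ext
        simp
        omega
    · simp [inner]
  right_inv x := by
    dsimp only
    split_ifs with h1 h2
    · simp [outer, Fin.lt_def, h1]
    · ext
      simp [inner]
      omega
    · have h3 : ¬ ((x : ℕ) + 1 - b < i) := by omega
      ext
      simp [outer, Fin.lt_def, h3]
      omega

/-- The permutation `σ ∘_i τ`: the old inputs `l ≠ i` are permuted by `σ`, the inputs of the
block inserted at `i` are permuted by `τ` and moved to the block inserted at `σ i`. -/
def permComp {a b c : ℕ} (h : a + b = c + 1) (i : Fin a)
    (σ : Equiv.Perm (Fin a)) (τ : Equiv.Perm (Fin b)) : Equiv.Perm (Fin c) :=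
  (slots h i).symm.trans
    ((Equiv.sumCongr (σ.subtypeEquiv (p := fun l => l ≠ i) (q := fun l => l ≠ σ i) (by simp)) τ).trans
      (slots h (σ i)))

/-! ### Graded Σ-modules and graded operads -/

/-- A graded `Σ`-module over `k`: for each arity `a` and degree `p` a vector space `obj a p`, with
a right action of the symmetric group on `a` letters (`act σ x` is `x · σ`). -/
structure SigmaModule (k : Type u) [Field k] where
  obj : ℕ → ℤ → Type v
  [addCommGroup : ∀ a p, AddCommGroup (obj a p)]
  [module : ∀ a p, Module k (obj a p)]
  act : ∀ {a : ℕ} {p : ℤ}, Equiv.Perm (Fin a) → obj a p →ₗ[k] obj a p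
  act_one : ∀ {a : ℕ} {p : ℤ} (x : obj a p), act 1 x = x
  act_mul : ∀ {a : ℕ} {p : ℤ} (σ τ : Equiv.Perm (Fin a)) (x : obj a p),
    act (σ * τ) x = act τ (act σ x)

attribute [instance] SigmaModule.addCommGroup SigmaModule.module

/-- A (symmetric, unital) operad in graded `k`-vector spaces, given by partial compositions
`comp h hp i x y`, which is `x ∘_i y`. The equations `h : a + b = c + 1` and `hp : p + q = r`
record the arity and the degree of the composite. -/
structure GradedOperad (k : Type u) [Field k] extends SigmaModule.{u, v} k where
  one : obj 1 0
  comp : ∀ {a b c : ℕ} {p q r : ℤ}, a + b = c + 1 → p + q = r → Fin a →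
    (obj a p →ₗ[k] obj b q →ₗ[k] obj c r)
  one_comp : ∀ {a : ℕ} {p : ℤ} (h : 1 + a = a + 1) (hp : 0 + p = p) (x : obj a p),
    comp h hp 0 one x = x
  comp_one : ∀ {a : ℕ} {p : ℤ} (h : a + 1 = a + 1) (hp : p + 0 = p) (i : Fin a) (x : obj a p),
    comp h hp i x one = x
  /-- Sequential associativity: `(x ∘_i y) ∘_{i+j} z = x ∘_i (y ∘_j z)`. -/
  comp_assoc : ∀ {a b c ab bc abc : ℕ} {p q r pq qr pqr : ℤ}
    (h₁ : a + b = ab + 1) (e₁ : p + q = pq) (h₂ : ab + c = abc + 1) (e₂ : pq + r = pqr)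
    (h₃ : b + c = bc + 1) (e₃ : q + r = qr) (h₄ : a + bc = abc + 1) (e₄ : p + qr = pqr)
    (i : Fin a) (j : Fin b) (x : obj a p) (y : obj b q) (z : obj c r),
    comp h₂ e₂ (inner h₁ i j) (comp h₁ e₁ i x y) z = comp h₄ e₄ i x (comp h₃ e₃ j y z)
  /-- Parallel associativity, with the Koszul sign: plugging `y` and `z` into two different inputs
  `i`, `l` of `x` in the two possible orders. -/
  comp_parallel : ∀ {a b c ab ac abc : ℕ} {p q r pq pr pqr : ℤ}
    (h₁ : a + b = ab + 1) (e₁ : p + q = pq) (h₂ : ab + c = abc + 1) (e₂ : pq + r = pqr)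
    (h₃ : a + c = ac + 1) (e₃ : p + r = pr) (h₄ : ac + b = abc + 1) (e₄ : pr + q = pqr)
    (i l : Fin a) (hil : l ≠ i) (x : obj a p) (y : obj b q) (z : obj c r),
    comp h₂ e₂ (outer h₁ i ⟨l, hil⟩) (comp h₁ e₁ i x y) z =
      koszulSign k q r • comp h₄ e₄ (outer h₃ l ⟨i, hil.symm⟩) (comp h₃ e₃ l x z) y
  /-- Equivariance: `(x · σ) ∘_i (y · τ) = (x ∘_{σ i} y) · (σ ∘_i τ)`. -/
  comp_act : ∀ {a b c : ℕ} {p q r : ℤ} (h : a + b = c + 1) (hp : p + q = r) (i : Fin a)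
    (σ : Equiv.Perm (Fin a)) (τ : Equiv.Perm (Fin b)) (x : obj a p) (y : obj b q),
    comp h hp i (act σ x) (act τ y) = act (permComp h i σ τ) (comp h hp (σ i) x y)

/-! ### The free operad on a Σ-module -/

section Free

variable {k : Type u} [Field k] (E : SigmaModule.{u, v} k)

/-- Formal expressions in the operations of a graded operad, with generators from `E`. -/
inductive Pre : ℕ → ℤ → Type (max u v)
  | gen {a : ℕ} {p : ℤ} (e : E.obj a p) : Pre a p
  | zero {a : ℕ} {p : ℤ} : Pre a p
  | add {a : ℕ} {p : ℤ} (x y : Pre a p) : Pre a p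
  | smul {a : ℕ} {p : ℤ} (s : k) (x : Pre a p) : Pre a p
  | act {a : ℕ} {p : ℤ} (σ : Equiv.Perm (Fin a)) (x : Pre a p) : Pre a p
  | one : Pre 1 0
  | comp {a b c : ℕ} {p q r : ℤ} (h : a + b = c + 1) (hp : p + q = r) (i : Fin a)
      (x : Pre a p) (y : Pre b q) : Pre c r

open Pre in
/-- The congruence on formal expressions generated by the vector space axioms, the axioms of a
graded operad, and the requirement that `E → Γ(E)` be a morphism of `Σ`-modules. -/
inductive Rel : ∀ {a : ℕ} {p : ℤ}, Pre E a p → Pre E a p → Prop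
  -- equivalence relation and congruence
  | refl {a : ℕ} {p : ℤ} (x : Pre E a p) : Rel x x
  | symm {a : ℕ} {p : ℤ} {x y : Pre E a p} : Rel x y → Rel y x
  | trans {a : ℕ} {p : ℤ} {x y z : Pre E a p} : Rel x y → Rel y z → Rel x z
  | add_congr {a : ℕ} {p : ℤ} {x x' y y' : Pre E a p} :
      Rel x x' → Rel y y' → Rel (add x y) (add x' y')
  | smul_congr {a : ℕ} {p : ℤ} (s : k) {x x' : Pre E a p} : Rel x x' → Rel (smul s x) (smul s x')
  | act_congr {a : ℕ} {p : ℤ} (σ : Equiv.Perm (Fin a)) {x x' : Pre E a p} :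
      Rel x x' → Rel (act σ x) (act σ x')
  | comp_congr {a b c : ℕ} {p q r : ℤ} (h : a + b = c + 1) (hp : p + q = r) (i : Fin a)
      {x x' : Pre E a p} {y y' : Pre E b q} :
      Rel x x' → Rel y y' → Rel (comp h hp i x y) (comp h hp i x' y')
  -- vector spaces
  | add_assoc {a : ℕ} {p : ℤ} (x y z : Pre E a p) : Rel (add (add x y) z) (add x (add y z))
  | add_comm {a : ℕ} {p : ℤ} (x y : Pre E a p) : Rel (add x y) (add y x)
  | zero_add {a : ℕ} {p : ℤ} (x : Pre E a p) : Rel (add zero x) x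
  | one_smul {a : ℕ} {p : ℤ} (x : Pre E a p) : Rel (smul 1 x) x
  | zero_smul {a : ℕ} {p : ℤ} (x : Pre E a p) : Rel (smul 0 x) zero
  | mul_smul {a : ℕ} {p : ℤ} (s t : k) (x : Pre E a p) : Rel (smul (s * t) x) (smul s (smul t x))
  | smul_add {a : ℕ} {p : ℤ} (s : k) (x y : Pre E a p) :
      Rel (smul s (add x y)) (add (smul s x) (smul s y))
  | add_smul {a : ℕ} {p : ℤ} (s t : k) (x : Pre E a p) :
      Rel (smul (s + t) x) (add (smul s x) (smul t x))
  -- linearity of the structure operations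
  | act_add {a : ℕ} {p : ℤ} (σ : Equiv.Perm (Fin a)) (x y : Pre E a p) :
      Rel (act σ (add x y)) (add (act σ x) (act σ y))
  | act_smul {a : ℕ} {p : ℤ} (σ : Equiv.Perm (Fin a)) (s : k) (x : Pre E a p) :
      Rel (act σ (smul s x)) (smul s (act σ x))
  | comp_add_left {a b c : ℕ} {p q r : ℤ} (h : a + b = c + 1) (hp : p + q = r) (i : Fin a)
      (x x' : Pre E a p) (y : Pre E b q) :
      Rel (comp h hp i (add x x') y) (add (comp h hp i x y) (comp h hp i x' y))
  | comp_smul_left {a b c : ℕ} {p q r : ℤ} (h : a + b = c + 1) (hp : p + q = r) (i : Fin a)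
      (s : k) (x : Pre E a p) (y : Pre E b q) :
      Rel (comp h hp i (smul s x) y) (smul s (comp h hp i x y))
  | comp_add_right {a b c : ℕ} {p q r : ℤ} (h : a + b = c + 1) (hp : p + q = r) (i : Fin a)
      (x : Pre E a p) (y y' : Pre E b q) :
      Rel (comp h hp i x (add y y')) (add (comp h hp i x y) (comp h hp i x y'))
  | comp_smul_right {a b c : ℕ} {p q r : ℤ} (h : a + b = c + 1) (hp : p + q = r) (i : Fin a)
      (s : k) (x : Pre E a p) (y : Pre E b q) :
      Rel (comp h hp i x (smul s y)) (smul s (comp h hp i x y))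
  -- the generators
  | gen_add {a : ℕ} {p : ℤ} (e f : E.obj a p) : Rel (gen (e + f)) (add (gen e) (gen f))
  | gen_smul {a : ℕ} {p : ℤ} (s : k) (e : E.obj a p) : Rel (gen (s • e)) (smul s (gen e))
  | gen_act {a : ℕ} {p : ℤ} (σ : Equiv.Perm (Fin a)) (e : E.obj a p) :
      Rel (gen (E.act σ e)) (act σ (gen e))
  -- operad axioms
  | act_one {a : ℕ} {p : ℤ} (x : Pre E a p) : Rel (act 1 x) x
  | act_mul {a : ℕ} {p : ℤ} (σ τ : Equiv.Perm (Fin a)) (x : Pre E a p) :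
      Rel (act (σ * τ) x) (act τ (act σ x))
  | one_comp {a : ℕ} {p : ℤ} (h : 1 + a = a + 1) (hp : 0 + p = p) (x : Pre E a p) :
      Rel (comp h hp 0 one x) x
  | comp_one {a : ℕ} {p : ℤ} (h : a + 1 = a + 1) (hp : p + 0 = p) (i : Fin a) (x : Pre E a p) :
      Rel (comp h hp i x one) x
  | comp_assoc {a b c ab bc abc : ℕ} {p q r pq qr pqr : ℤ}
      (h₁ : a + b = ab + 1) (e₁ : p + q = pq) (h₂ : ab + c = abc + 1) (e₂ : pq + r = pqr)
      (h₃ : b + c = bc + 1) (e₃ : q + r = qr) (h₄ : a + bc = abc + 1) (e₄ : p + qr = pqr)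
      (i : Fin a) (j : Fin b) (x : Pre E a p) (y : Pre E b q) (z : Pre E c r) :
      Rel (comp h₂ e₂ (inner h₁ i j) (comp h₁ e₁ i x y) z) (comp h₄ e₄ i x (comp h₃ e₃ j y z))
  | comp_parallel {a b c ab ac abc : ℕ} {p q r pq pr pqr : ℤ}
      (h₁ : a + b = ab + 1) (e₁ : p + q = pq) (h₂ : ab + c = abc + 1) (e₂ : pq + r = pqr)
      (h₃ : a + c = ac + 1) (e₃ : p + r = pr) (h₄ : ac + b = abc + 1) (e₄ : pr + q = pqr)
      (i l : Fin a) (hil : l ≠ i) (x : Pre E a p) (y : Pre E b q) (z : Pre E c r) :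
      Rel (comp h₂ e₂ (outer h₁ i ⟨l, hil⟩) (comp h₁ e₁ i x y) z)
        (smul (koszulSign k q r) (comp h₄ e₄ (outer h₃ l ⟨i, hil.symm⟩) (comp h₃ e₃ l x z) y))
  | comp_act {a b c : ℕ} {p q r : ℤ} (h : a + b = c + 1) (hp : p + q = r) (i : Fin a)
      (σ : Equiv.Perm (Fin a)) (τ : Equiv.Perm (Fin b)) (x : Pre E a p) (y : Pre E b q) :
      Rel (comp h hp i (act σ x) (act τ y)) (act (permComp h i σ τ) (comp h hp (σ i) x y))

/-- The congruence as a setoid. -/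
def preSetoid (a : ℕ) (p : ℤ) : Setoid (Pre E a p) :=
  ⟨Rel E, Rel.refl, Rel.symm, Rel.trans⟩

/-- The component of arity `a` and degree `p` of the free operad. -/
def FreeObj (a : ℕ) (p : ℤ) : Type (max u v) := Quotient (preSetoid E a p)

/-- The class of a formal expression. -/
def FreeObj.mk {a : ℕ} {p : ℤ} (x : Pre E a p) : FreeObj E a p := Quotient.mk (preSetoid E a p) x

theorem FreeObj.sound {a : ℕ} {p : ℤ} {x y : Pre E a p} (h : Rel E x y) :
    FreeObj.mk E x = FreeObj.mk E y :=
  Quotient.sound (s := preSetoid E a p) h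

@[elab_as_elim]
theorem FreeObj.ind {a : ℕ} {p : ℤ} {motive : FreeObj E a p → Prop}
    (h : ∀ x, motive (FreeObj.mk E x)) (x : FreeObj E a p) : motive x :=
  Quotient.ind (s := preSetoid E a p) h x

instance (a : ℕ) (p : ℤ) : Zero (FreeObj E a p) := ⟨FreeObj.mk E Pre.zero⟩

instance (a : ℕ) (p : ℤ) : Add (FreeObj E a p) :=
  ⟨Quotient.map₂ Pre.add fun _ _ h _ _ h' => Rel.add_congr h h'⟩

instance (a : ℕ) (p : ℤ) : SMul k (FreeObj E a p) :=
  ⟨fun s => Quotient.map (Pre.smul s) fun _ _ h => Rel.smul_congr s h⟩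

instance (a : ℕ) (p : ℤ) : Neg (FreeObj E a p) := ⟨fun x => (-1 : k) • x⟩

theorem FreeObj.zero_smul' {a : ℕ} {p : ℤ} (x : FreeObj E a p) : (0 : k) • x = 0 :=
  FreeObj.ind E (fun x => FreeObj.sound E (Rel.zero_smul x)) x

theorem FreeObj.one_smul' {a : ℕ} {p : ℤ} (x : FreeObj E a p) : (1 : k) • x = x :=
  FreeObj.ind E (fun x => FreeObj.sound E (Rel.one_smul x)) x

theorem FreeObj.add_smul' {a : ℕ} {p : ℤ} (s t : k) (x : FreeObj E a p) :
    (s + t) • x = s • x + t • x :=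
  FreeObj.ind E (fun x => FreeObj.sound E (Rel.add_smul s t x)) x

theorem FreeObj.mul_smul' {a : ℕ} {p : ℤ} (s t : k) (x : FreeObj E a p) :
    (s * t) • x = s • t • x :=
  FreeObj.ind E (fun x => FreeObj.sound E (Rel.mul_smul s t x)) x

theorem FreeObj.smul_add' {a : ℕ} {p : ℤ} (s : k) (x y : FreeObj E a p) :
    s • (x + y) = s • x + s • y :=
  FreeObj.ind E (fun x => FreeObj.ind E
    (fun y => FreeObj.sound E (Rel.smul_add s x y)) y) x

theorem FreeObj.add_comm' {a : ℕ} {p : ℤ} (x y : FreeObj E a p) : x + y = y + x :=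
  FreeObj.ind E (fun x => FreeObj.ind E (fun y => FreeObj.sound E (Rel.add_comm x y)) y) x

theorem FreeObj.zero_add' {a : ℕ} {p : ℤ} (x : FreeObj E a p) : 0 + x = x :=
  FreeObj.ind E (fun x => FreeObj.sound E (Rel.zero_add x)) x

theorem FreeObj.add_assoc' {a : ℕ} {p : ℤ} (x y z : FreeObj E a p) : x + y + z = x + (y + z) :=
  FreeObj.ind E (fun x => FreeObj.ind E (fun y => FreeObj.ind E
    (fun z => FreeObj.sound E (Rel.add_assoc x y z)) z) y) x

instance (a : ℕ) (p : ℤ) : AddCommGroup (FreeObj E a p) where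
  add_assoc := FreeObj.add_assoc' E
  add_comm := FreeObj.add_comm' E
  zero_add := FreeObj.zero_add' E
  add_zero x := by rw [FreeObj.add_comm', FreeObj.zero_add']
  neg_add_cancel x := by
    change (-1 : k) • x + x = 0
    conv_lhs => rw [← FreeObj.one_smul' E x]
    rw [← FreeObj.mul_smul', ← FreeObj.add_smul']
    simp [FreeObj.zero_smul']
  nsmul := nsmulRec
  zsmul := zsmulRec

instance (a : ℕ) (p : ℤ) : Module k (FreeObj E a p) where
  one_smul := FreeObj.one_smul' E
  mul_smul := FreeObj.mul_smul' E
  smul_add := FreeObj.smul_add' E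
  add_smul := FreeObj.add_smul' E
  zero_smul := FreeObj.zero_smul' E
  smul_zero s := by
    rw [← FreeObj.zero_smul' E (0 : FreeObj E a p), ← FreeObj.mul_smul']
    simp

/-- The action of permutations on the free operad. -/
def freeAct {a : ℕ} {p : ℤ} (σ : Equiv.Perm (Fin a)) : FreeObj E a p →ₗ[k] FreeObj E a p where
  toFun := Quotient.map (Pre.act σ) fun _ _ h => Rel.act_congr σ h
  map_add' x y := FreeObj.ind E (fun x => FreeObj.ind E
    (fun y => FreeObj.sound E (Rel.act_add σ x y)) y) x
  map_smul' s x := FreeObj.ind E (fun x => FreeObj.sound E (Rel.act_smul σ s x)) x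

/-- Partial compositions in the free operad. -/
def freeComp {a b c : ℕ} {p q r : ℤ} (h : a + b = c + 1) (hp : p + q = r) (i : Fin a) :
    FreeObj E a p →ₗ[k] FreeObj E b q →ₗ[k] FreeObj E c r :=
  LinearMap.mk₂ k
    (Quotient.map₂ (Pre.comp h hp i) fun _ _ h₁ _ _ h₂ => Rel.comp_congr h hp i h₁ h₂)
    (fun x x' y => FreeObj.ind E (fun x => FreeObj.ind E (fun x' => FreeObj.ind E
      (fun y => FreeObj.sound E (Rel.comp_add_left h hp i x x' y)) y) x') x)
    (fun s x y => FreeObj.ind E (fun x => FreeObj.ind E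
      (fun y => FreeObj.sound E (Rel.comp_smul_left h hp i s x y)) y) x)
    (fun x y y' => FreeObj.ind E (fun x => FreeObj.ind E (fun y => FreeObj.ind E
      (fun y' => FreeObj.sound E (Rel.comp_add_right h hp i x y y')) y') y) x)
    (fun s x y => FreeObj.ind E (fun x => FreeObj.ind E
      (fun y => FreeObj.sound E (Rel.comp_smul_right h hp i s x y)) y) x)

/-- The free operad `Γ(E)` on a graded `Σ`-module `E`. -/
def freeOperad : GradedOperad.{u, max u v} k where
  obj := FreeObj E
  act := freeAct E
  act_one x := FreeObj.ind E (fun x => FreeObj.sound E (Rel.act_one x)) x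
  act_mul σ τ x := FreeObj.ind E (fun x => FreeObj.sound E (Rel.act_mul σ τ x)) x
  one := FreeObj.mk E Pre.one
  comp := freeComp E
  one_comp h hp x := FreeObj.ind E (fun x => FreeObj.sound E (Rel.one_comp h hp x)) x
  comp_one h hp i x := FreeObj.ind E (fun x => FreeObj.sound E (Rel.comp_one h hp i x)) x
  comp_assoc h₁ e₁ h₂ e₂ h₃ e₃ h₄ e₄ i j x y z :=
    FreeObj.ind E (fun x => FreeObj.ind E (fun y => FreeObj.ind E (fun z =>
      FreeObj.sound E (Rel.comp_assoc h₁ e₁ h₂ e₂ h₃ e₃ h₄ e₄ i j x y z)) z) y) x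
  comp_parallel h₁ e₁ h₂ e₂ h₃ e₃ h₄ e₄ i l hil x y z :=
    FreeObj.ind E (fun x => FreeObj.ind E (fun y => FreeObj.ind E (fun z =>
      FreeObj.sound E (Rel.comp_parallel h₁ e₁ h₂ e₂ h₃ e₃ h₄ e₄ i l hil x y z)) z) y) x
  comp_act h hp i σ τ x y :=
    FreeObj.ind E (fun x => FreeObj.ind E (fun y =>
      FreeObj.sound E (Rel.comp_act h hp i σ τ x y)) y) x

/-- The image in `Γ(E)` of an element of `E`. -/
def freeGen {a : ℕ} {p : ℤ} (e : E.obj a p) : (freeOperad E).obj a p :=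
  FreeObj.mk E (Pre.gen e)

end Free

/-! ### Operadic ideals and quotients -/

section Quotient

variable {k : Type u} [Field k] (P : GradedOperad.{u, v} k)
  (R : ∀ (a : ℕ) (p : ℤ), Set (P.obj a p))

/-- Membership in the operadic ideal `(R)`: the smallest family of subspaces that contains `R` and
is closed under the symmetric group actions and under composition, on either side, with arbitrary
elements of `P`. -/
inductive InIdeal : ∀ {a : ℕ} {p : ℤ}, P.obj a p → Prop
  | of {a : ℕ} {p : ℤ} {x : P.obj a p} : x ∈ R a p → InIdeal x
  | zero {a : ℕ} {p : ℤ} : InIdeal (0 : P.obj a p)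
  | add {a : ℕ} {p : ℤ} {x y : P.obj a p} : InIdeal x → InIdeal y → InIdeal (x + y)
  | smul {a : ℕ} {p : ℤ} (s : k) {x : P.obj a p} : InIdeal x → InIdeal (s • x)
  | act {a : ℕ} {p : ℤ} (σ : Equiv.Perm (Fin a)) {x : P.obj a p} :
      InIdeal x → InIdeal (P.act σ x)
  | comp_left {a b c : ℕ} {p q r : ℤ} (h : a + b = c + 1) (hp : p + q = r) (i : Fin a)
      {x : P.obj a p} (y : P.obj b q) : InIdeal x → InIdeal (P.comp h hp i x y)
  | comp_right {a b c : ℕ} {p q r : ℤ} (h : a + b = c + 1) (hp : p + q = r) (i : Fin a)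
      (x : P.obj a p) {y : P.obj b q} : InIdeal y → InIdeal (P.comp h hp i x y)

/-- The component of arity `a` and degree `p` of the operadic ideal `(R)`. -/
def ideal (a : ℕ) (p : ℤ) : Submodule k (P.obj a p) where
  carrier := {x | InIdeal P R x}
  zero_mem' := InIdeal.zero
  add_mem' := InIdeal.add
  smul_mem' s _ := InIdeal.smul s

/-- The action on the quotient. -/
def quotAct {a : ℕ} {p : ℤ} (σ : Equiv.Perm (Fin a)) :
    (P.obj a p ⧸ ideal P R a p) →ₗ[k] (P.obj a p ⧸ ideal P R a p) :=
  (ideal P R a p).mapQ (ideal P R a p) (P.act σ) fun _ hx => InIdeal.act σ hx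

/-- Partial compositions on the quotient. -/
def quotComp {a b c : ℕ} {p q r : ℤ} (h : a + b = c + 1) (hp : p + q = r) (i : Fin a) :
    (P.obj a p ⧸ ideal P R a p) →ₗ[k] (P.obj b q ⧸ ideal P R b q) →ₗ[k]
      (P.obj c r ⧸ ideal P R c r) :=
  (ideal P R a p).liftQ
    { toFun := fun x => (ideal P R b q).mapQ (ideal P R c r) (P.comp h hp i x)
        fun _ hy => InIdeal.comp_right h hp i x hy
      map_add' := fun x x' => by
        ext y
        exact congrArg Submodule.Quotient.mk (by simp)
      map_smul' := fun s x => by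
        ext y
        exact congrArg Submodule.Quotient.mk (by simp) }
    (fun x hx => by
      rw [LinearMap.mem_ker]
      ext y
      exact (Submodule.Quotient.mk_eq_zero (ideal P R c r)).2 (InIdeal.comp_left h hp i y hx))

/-- The quotient operad `P/(R)`. -/
def quotOperad : GradedOperad.{u, v} k where
  obj a p := P.obj a p ⧸ ideal P R a p
  act := quotAct P R
  act_one x := by
    induction x using Submodule.Quotient.induction_on with | _ x
    exact congrArg (Submodule.Quotient.mk) (P.act_one x)
  act_mul σ τ x := by
    induction x using Submodule.Quotient.induction_on with | _ x
    exact congrArg (Submodule.Quotient.mk) (P.act_mul σ τ x)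
  one := Submodule.Quotient.mk P.one
  comp := quotComp P R
  one_comp h hp x := by
    induction x using Submodule.Quotient.induction_on with | _ x
    exact congrArg (Submodule.Quotient.mk) (P.one_comp h hp x)
  comp_one h hp i x := by
    induction x using Submodule.Quotient.induction_on with | _ x
    exact congrArg (Submodule.Quotient.mk) (P.comp_one h hp i x)
  comp_assoc h₁ e₁ h₂ e₂ h₃ e₃ h₄ e₄ i j x y z := by
    induction x using Submodule.Quotient.induction_on with | _ x
    induction y using Submodule.Quotient.induction_on with | _ y
    induction z using Submodule.Quotient.induction_on with | _ z
    exact congrArg (Submodule.Quotient.mk) (P.comp_assoc h₁ e₁ h₂ e₂ h₃ e₃ h₄ e₄ i j x y z)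
  comp_parallel h₁ e₁ h₂ e₂ h₃ e₃ h₄ e₄ i l hil x y z := by
    induction x using Submodule.Quotient.induction_on with | _ x
    induction y using Submodule.Quotient.induction_on with | _ y
    induction z using Submodule.Quotient.induction_on with | _ z
    exact congrArg (Submodule.Quotient.mk) (P.comp_parallel h₁ e₁ h₂ e₂ h₃ e₃ h₄ e₄ i l hil x y z)
  comp_act h hp i σ τ x y := by
    induction x using Submodule.Quotient.induction_on with | _ x
    induction y using Submodule.Quotient.induction_on with | _ y
    exact congrArg (Submodule.Quotient.mk) (P.comp_act h hp i σ τ x y)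

end Quotient

/-! ### The operad of totally associative `n`-ary algebras -/

section TAss

variable (k : Type u) [Field k] (n : ℕ) (d : ℤ)

/-- The `Σ`-module `E_μ`: the regular representation `k[Σ_n]` in arity `n` and degree `d`,
and zero elsewhere (the index type of the basis is empty there). -/
noncomputable def regularModule : SigmaModule.{u, u} k where
  obj a p := {_σ : Equiv.Perm (Fin a) // a = n ∧ p = d} →₀ k
  act σ := Finsupp.lmapDomain k k fun τ => ⟨τ.1 * σ, τ.2⟩
  act_one x := by
    simp only [Finsupp.lmapDomain_apply, mul_one]
    exact Finsupp.mapDomain_id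
  act_mul σ τ x := by
    simp only [Finsupp.lmapDomain_apply]
    rw [← Finsupp.mapDomain_comp]
    simp [Function.comp_def, mul_assoc]

/-- The generator `μ` of `Γ(μ)`, the free operad on `E_μ`. -/
noncomputable def mu : (freeOperad (regularModule k n d)).obj n d :=
  freeGen (regularModule k n d)
    (Finsupp.single (⟨1, rfl, rfl⟩ : {_σ : Equiv.Perm (Fin n) // n = n ∧ d = d}) (1 : k))

/-- The relators `μ ∘_i μ - μ ∘_j μ`, of arity `2n - 1` and degree `2d`. -/
def tAssRelators (a : ℕ) (p : ℤ) : Set ((freeOperad (regularModule k n d)).obj a p) :=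
  {x | ∃ (h : n + n = a + 1) (hp : d + d = p) (i j : Fin n),
    x = (freeOperad (regularModule k n d)).comp h hp i (mu k n d) (mu k n d) -
      (freeOperad (regularModule k n d)).comp h hp j (mu k n d) (mu k n d)}

/-- The operad `tAss^n_d = Γ(μ)/(μ ∘_i μ - μ ∘_j μ)`. -/
noncomputable def tAss : GradedOperad.{u, u} k :=
  quotOperad (freeOperad (regularModule k n d)) (tAssRelators k n d)

end TAss

/-! ### Poincaré series -/

section Poincare

variable {k : Type u} [Field k] (P : GradedOperad.{u, v} k)

/-- Each `P(a)` has finite total dimension, so that its Euler characteristic makes sense. -/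
def FiniteTotalDim : Prop :=
  ∀ a : ℕ, (∀ p : ℤ, Module.Finite k (P.obj a p)) ∧ {p : ℤ | Nontrivial (P.obj a p)}.Finite

/-- The Euler characteristic `∑_i (-1)^i dim P_i(a)`. -/
noncomputable def eulerChar (a : ℕ) : ℤ :=
  ∑ᶠ i : ℤ, ((i.negOnePow : ℤˣ) : ℤ) * (Module.finrank k (P.obj a i) : ℤ)

/-- The Poincaré series `∑_{a ≥ 1} χ(P(a)) t^a / a!`. -/
noncomputable def poincareSeries : PowerSeries ℚ :=
  PowerSeries.mk fun a => if a = 0 then 0 else (eulerChar P a : ℚ) / (a.factorial : ℚ)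

end Poincare

end NAry

-- The proof bounds each component from above by a spanning set and from below by an explicit model.
--
-- Upper bound. Let μ^m be the m-fold iterate of μ, plugged always into the first input (`power`).
-- By sequential associativity the relation μ ∘_i μ = μ ∘_j μ lets an insertion move freely among
-- the inputs of the copy of μ inserted last; parallel associativity exchanges two insertions at the
-- cost of a sign. Hence a composite of two iterates is a scalar multiple of an iterate
-- (`exists_power_comp_power`), and by equivariance the translates of the iterates span the whole
-- operad (`monomialSpan_tAss`). Since n ≥ 2, the arity a = m(n-1)+1 determines m, so each arity
-- carries at most the one degree md, with dimension at most a!.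
--
-- If d is odd, inserting two copies of μ into two inputs of a third one in the two possible orders
-- gives opposite results, while total associativity identifies both with μ^3. So 2μ^3 = 0, and in
-- characteristic zero all iterates from the third on vanish (`power_three_eq_zero`).
--
-- Lower bound. The model has the regular representation in every surviving arity and composes basis
-- elements as block permutations, with no sign. It satisfies the signed parallel axiom because no
-- sign is ever visible there. For d even all Koszul signs are 1. For d odd the model is cut off at
-- m ≤ 2, and a composite below the cutoff never contains two odd operations plugged into a third
-- (`Admissible.koszulSign_eq_one`). The relators vanish in the model, and the translates of μ^m go
-- to distinct basis vectors. Hence the dimension is exactly a!, and the coefficient of t^a is the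
-- sign (-1)^(md).

universe w

namespace NAry

/-! ### Maps out of a free operad and out of its quotients -/

section Lift

variable {k : Type u} [Field k] {E : SigmaModule.{u, v} k} (Q : GradedOperad.{u, w} k)
  (f : ∀ a p, E.obj a p →ₗ[k] Q.obj a p)

/-- The value in `Q` of a formal expression, given the values of the generators. -/
def Pre.eval : ∀ {a : ℕ} {p : ℤ}, Pre E a p → Q.obj a p
  | _, _, .gen e => f _ _ e
  | _, _, .zero => 0
  | _, _, .add x y => x.eval + y.eval
  | _, _, .smul s x => s • x.eval
  | _, _, .act σ x => Q.act σ x.eval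
  | _, _, .one => Q.one
  | _, _, .comp h hp i x y => Q.comp h hp i x.eval y.eval

variable (hf : ∀ (a : ℕ) (p : ℤ) (σ : Equiv.Perm (Fin a)) (e : E.obj a p),
  f a p (E.act σ e) = Q.act σ (f a p e))

include hf in
-- Every generating rule of the congruence is a formal rule or an axiom that holds in `Q`; `hf`
-- serves only for `gen_act`.
theorem Rel.eval_eq {a : ℕ} {p : ℤ} {x y : Pre E a p} (h : Rel E x y) :
    x.eval Q f = y.eval Q f := by
  induction h with
  | refl => rfl
  | symm _ ih => exact ih.symm
  | trans _ _ ih ih' => exact ih.trans ih'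
  | add_congr _ _ ih ih' => simp only [Pre.eval, ih, ih']
  | smul_congr _ _ ih => simp only [Pre.eval, ih]
  | act_congr _ _ ih => simp only [Pre.eval, ih]
  | comp_congr _ _ _ _ _ ih ih' => simp only [Pre.eval, ih, ih']
  | add_assoc => exact _root_.add_assoc _ _ _
  | add_comm => exact _root_.add_comm _ _
  | zero_add => exact _root_.zero_add _
  | one_smul => exact _root_.one_smul _ _
  | zero_smul => exact _root_.zero_smul _ _
  | mul_smul => exact SemigroupAction.mul_smul _ _ _
  | smul_add => exact _root_.smul_add _ _ _
  | add_smul => exact _root_.add_smul _ _ _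
  | act_add => exact map_add _ _ _
  | act_smul => exact map_smul _ _ _
  | comp_add_left => exact LinearMap.map_add₂ _ _ _ _
  | comp_smul_left => exact LinearMap.map_smul₂ _ _ _ _
  | comp_add_right => exact map_add _ _ _
  | comp_smul_right => exact map_smul _ _ _
  | gen_add => exact map_add _ _ _
  | gen_smul => exact map_smul _ _ _
  | gen_act => exact hf _ _ _ _
  | act_one => exact Q.act_one _
  | act_mul => exact Q.act_mul _ _ _
  | one_comp => exact Q.one_comp _ _ _
  | comp_one => exact Q.comp_one _ _ _ _
  | comp_assoc => exact Q.comp_assoc _ _ _ _ _ _ _ _ _ _ _ _ _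
  | comp_parallel => exact Q.comp_parallel _ _ _ _ _ _ _ _ _ _ _ _ _ _
  | comp_act => exact Q.comp_act _ _ _ _ _ _ _

/-- The morphism from the free operad induced by a morphism of `Σ`-modules. -/
def freeLift (a : ℕ) (p : ℤ) : (freeOperad E).obj a p →ₗ[k] Q.obj a p where
  toFun := Quotient.lift (fun x : Pre E a p => x.eval Q f) fun _ _ h => Rel.eval_eq Q f hf h
  map_add' x y := FreeObj.ind E (fun _ => FreeObj.ind E (fun _ => rfl) y) x
  map_smul' _ x := FreeObj.ind E (fun _ => rfl) x

theorem freeLift_gen {a : ℕ} {p : ℤ} (e : E.obj a p) :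
    freeLift Q f hf a p (freeGen E e) = f a p e := rfl

theorem freeLift_act {a : ℕ} {p : ℤ} (σ : Equiv.Perm (Fin a)) (x : (freeOperad E).obj a p) :
    freeLift Q f hf a p ((freeOperad E).act σ x) = Q.act σ (freeLift Q f hf a p x) :=
  FreeObj.ind E (fun _ => rfl) x

theorem freeLift_comp {a b c : ℕ} {p q r : ℤ} (h : a + b = c + 1) (hp : p + q = r) (i : Fin a)
    (x : (freeOperad E).obj a p) (y : (freeOperad E).obj b q) :
    freeLift Q f hf c r ((freeOperad E).comp h hp i x y) =
      Q.comp h hp i (freeLift Q f hf a p x) (freeLift Q f hf b q y) :=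
  FreeObj.ind E (fun _ => FreeObj.ind E (fun _ => rfl) y) x

/-- A family of subspaces of the free operad that contains the unit and the generators and is
closed under the operad structure is everything. -/
theorem freeOperad_mem_of_closed (S : ∀ a p, Submodule k ((freeOperad E).obj a p))
    (hgen : ∀ {a p} (e : E.obj a p), freeGen E e ∈ S a p)
    (hone : (freeOperad E).one ∈ S 1 0)
    (hact : ∀ {a p} (σ : Equiv.Perm (Fin a)) (x), x ∈ S a p → (freeOperad E).act σ x ∈ S a p)
    (hcomp : ∀ {a b c : ℕ} {p q r : ℤ} (h : a + b = c + 1) (hp : p + q = r) (i : Fin a) (x y),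
      x ∈ S a p → y ∈ S b q → (freeOperad E).comp h hp i x y ∈ S c r)
    {a : ℕ} {p : ℤ} (x : (freeOperad E).obj a p) : x ∈ S a p := by
  refine FreeObj.ind E (fun x => ?_) x
  induction x with
  | gen e => exact hgen e
  | zero => exact (S _ _).zero_mem
  -- The induction also generalizes over the original element, which shares the indices `a` and `p`;
  -- `0` fills that vacuous argument.
  | add _ _ ihx ihy => exact (S _ _).add_mem (ihx 0) (ihy 0)
  | smul s _ ih => exact (S _ _).smul_mem s (ih 0)
  | act σ _ ih => exact hact σ _ (ih 0)
  | one => exact hone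
  | comp h hp i _ _ ihx ihy => exact hcomp h hp i _ _ (ihx 0) (ihy 0)

variable (R : ∀ (a : ℕ) (p : ℤ), Set ((freeOperad E).obj a p))
  (hR : ∀ (a : ℕ) (p : ℤ), ∀ x ∈ R a p, freeLift Q f hf a p x = 0)

include hR in
theorem freeLift_eq_zero_of_inIdeal {a : ℕ} {p : ℤ} {x : (freeOperad E).obj a p}
    (hx : InIdeal (freeOperad E) R x) : freeLift Q f hf a p x = 0 := by
  induction hx with
  | of h => exact hR _ _ _ h
  | zero => exact map_zero _
  | add _ _ ih ih' => rw [map_add, ih, ih', add_zero]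
  | smul s _ ih => rw [map_smul, ih, smul_zero]
  | act σ _ ih => rw [freeLift_act, ih, map_zero]
  | comp_left h hp i y _ ih => rw [freeLift_comp, ih, LinearMap.map_zero₂]
  | comp_right h hp i x _ ih => rw [freeLift_comp, ih, map_zero]

/-- The morphism from a quotient of the free operad. -/
def quotLift (a : ℕ) (p : ℤ) : (quotOperad (freeOperad E) R).obj a p →ₗ[k] Q.obj a p :=
  (ideal (freeOperad E) R a p).liftQ (freeLift Q f hf a p)
    fun _ hx => freeLift_eq_zero_of_inIdeal Q f hf R hR hx

theorem quotLift_act {a : ℕ} {p : ℤ} (σ : Equiv.Perm (Fin a))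
    (x : (quotOperad (freeOperad E) R).obj a p) :
    quotLift Q f hf R hR a p ((quotOperad (freeOperad E) R).act σ x) =
      Q.act σ (quotLift Q f hf R hR a p x) := by
  induction x using Submodule.Quotient.induction_on with | _ x
  exact freeLift_act Q f hf σ x

theorem quotLift_comp {a b c : ℕ} {p q r : ℤ} (h : a + b = c + 1) (hp : p + q = r) (i : Fin a)
    (x : (quotOperad (freeOperad E) R).obj a p) (y : (quotOperad (freeOperad E) R).obj b q) :
    quotLift Q f hf R hR c r ((quotOperad (freeOperad E) R).comp h hp i x y) =
      Q.comp h hp i (quotLift Q f hf R hR a p x) (quotLift Q f hf R hR b q y) := by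
  induction x using Submodule.Quotient.induction_on with | _ x
  induction y using Submodule.Quotient.induction_on with | _ y
  exact freeLift_comp Q f hf h hp i x y

end Lift

/-! ### Block permutations -/

section Perm

theorem inner_or_outer {a b c : ℕ} (h : a + b = c + 1) (i : Fin a) (x : Fin c) :
    (∃ j, x = inner h i j) ∨ ∃ l, x = outer h i l := by
  obtain ⟨s, rfl⟩ := (slots h i).surjective x
  rcases s with l | j
  · exact Or.inr ⟨l, rfl⟩
  · exact Or.inl ⟨j, rfl⟩

theorem inner_ne_outer {a b c : ℕ} (h : a + b = c + 1) (i : Fin a) (j : Fin b)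
    (l : {l : Fin a // l ≠ i}) : inner h i j ≠ outer h i l := fun e =>
  Sum.inr_ne_inl ((slots h i).injective (a₁ := Sum.inr j) (a₂ := Sum.inl l) e)

theorem outer_injective {a b c : ℕ} (h : a + b = c + 1) (i : Fin a) :
    Function.Injective (outer h i) := fun j j' e =>
  Sum.inl_injective ((slots h i).injective (a₁ := Sum.inl j) (a₂ := Sum.inl j') e)

theorem permComp_inner {a b c : ℕ} (h : a + b = c + 1) (i : Fin a)
    (σ : Equiv.Perm (Fin a)) (τ : Equiv.Perm (Fin b)) (j : Fin b) :
    permComp h i σ τ (inner h i j) = inner h (σ i) (τ j) := by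
  have : inner h i j = slots h i (Sum.inr j) := rfl
  simp only [permComp, Equiv.trans_apply, this, Equiv.symm_apply_apply]
  rfl

theorem permComp_outer {a b c : ℕ} (h : a + b = c + 1) (i : Fin a)
    (σ : Equiv.Perm (Fin a)) (τ : Equiv.Perm (Fin b)) (l : {l : Fin a // l ≠ i}) :
    permComp h i σ τ (outer h i l) =
      outer h (σ i) ⟨σ l.1, fun e => l.2 (σ.injective e)⟩ := by
  have : outer h i l = slots h i (Sum.inl l) := rfl
  simp only [permComp, Equiv.trans_apply, this, Equiv.symm_apply_apply]
  rfl

theorem permComp_one_one {a b c : ℕ} (h : a + b = c + 1) (i : Fin a) :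
    permComp h i 1 1 = 1 := by
  ext x
  rcases inner_or_outer h i x with ⟨j, rfl⟩ | ⟨l, rfl⟩
  · rw [permComp_inner]; rfl
  · rw [permComp_outer]; rfl

/-- Functoriality of block permutations; this is what equivariance of the model reduces to. -/
theorem permComp_mul {a b c : ℕ} (h : a + b = c + 1) (i : Fin a)
    (σ' σ : Equiv.Perm (Fin a)) (τ' τ : Equiv.Perm (Fin b)) :
    permComp h i (σ' * σ) (τ' * τ) = permComp h (σ i) σ' τ' * permComp h i σ τ := by
  ext x
  rcases inner_or_outer h i x with ⟨j, rfl⟩ | ⟨l, rfl⟩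
  · simp only [Equiv.Perm.mul_apply, permComp_inner]
  · simp only [Equiv.Perm.mul_apply, permComp_outer]

theorem inner_one {a : ℕ} (h : 1 + a = a + 1) (j : Fin a) : inner h 0 j = j := by
  ext; simp [inner]

theorem inner_one_right {a : ℕ} (h : a + 1 = a + 1) (i : Fin a) (j : Fin 1) :
    inner h i j = i := by
  ext; simp [inner]

theorem outer_one_right {a : ℕ} (h : a + 1 = a + 1) (i : Fin a) (l : {l : Fin a // l ≠ i}) :
    outer h i l = l := by
  ext; simp only [outer]; split <;> simp

theorem permComp_one_left {a : ℕ} (h : 1 + a = a + 1) (τ : Equiv.Perm (Fin a)) :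
    permComp h 0 1 τ = τ := by
  ext x
  conv_lhs => rw [← inner_one h x, permComp_inner]
  simp [inner]

theorem permComp_one_right {a : ℕ} (h : a + 1 = a + 1) (i : Fin a) (σ : Equiv.Perm (Fin a)) :
    permComp h i σ 1 = σ := by
  ext x
  rcases inner_or_outer h i x with ⟨j, rfl⟩ | ⟨l, rfl⟩
  · rw [permComp_inner, inner_one_right, inner_one_right]
  · rw [permComp_outer, outer_one_right, outer_one_right]

theorem inner_val {a b c : ℕ} (h : a + b = c + 1) (i : Fin a) (j : Fin b) :
    (inner h i j : ℕ) = i + j := rfl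

theorem outer_val {a b c : ℕ} (h : a + b = c + 1) (i : Fin a) (l : Fin a) (hl : l ≠ i) :
    (outer h i ⟨l, hl⟩ : ℕ) = if (l : ℕ) < i then (l : ℕ) else l + b - 1 := by
  simp only [outer, Fin.lt_def]
  split_ifs <;> rfl

/-- Changes both positions at once, which a plain rewrite cannot do because the proof of `l ≠ i`
depends on them. -/
theorem outer_congr {a b c : ℕ} (h : a + b = c + 1) {i i' l l' : Fin a} (hi : i = i')
    (hl : l = l') (hil : l ≠ i) : outer h i ⟨l, hil⟩ = outer h i' ⟨l', hi ▸ hl ▸ hil⟩ := by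
  subst hi hl
  rfl

section Nested

variable {a b c ab bc ac abc : ℕ} (h₁ : a + b = ab + 1) (h₂ : ab + c = abc + 1)

section Sequential

variable (h₃ : b + c = bc + 1) (h₄ : a + bc = abc + 1) (i : Fin a) (j : Fin b)

theorem inner_inner (s : Fin c) :
    inner h₂ (inner h₁ i j) s = inner h₄ i (inner h₃ j s) := by
  ext; simp [inner, add_assoc]

theorem outer_inner_inner (t : Fin b) (ht : t ≠ j) (ht' : inner h₁ i t ≠ inner h₁ i j) :
    outer h₂ (inner h₁ i j) ⟨inner h₁ i t, ht'⟩ = inner h₄ i (outer h₃ j ⟨t, ht⟩) := by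
  have : (t : ℕ) ≠ j := fun e => ht (Fin.ext e)
  ext
  simp only [inner_val, outer_val, Nat.add_lt_add_iff_left]
  split_ifs <;> omega

theorem outer_inner_outer (l : Fin a) (hli : l ≠ i)
    (hl : outer h₁ i ⟨l, hli⟩ ≠ inner h₁ i j) :
    outer h₂ (inner h₁ i j) ⟨outer h₁ i ⟨l, hli⟩, hl⟩ = outer h₄ i ⟨l, hli⟩ := by
  have : (l : ℕ) ≠ i := fun e => hli (Fin.ext e)
  ext
  simp only [inner_val, outer_val]
  split_ifs <;> omega

/-- An input of the triple composite lies in the innermost block, in the rest of the middle block,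
or outside both. In each case the two bracketings place it at the same position, before and after
permuting. -/
theorem permComp_assoc (σ : Equiv.Perm (Fin a)) (τ : Equiv.Perm (Fin b))
    (ρ : Equiv.Perm (Fin c)) :
    permComp h₂ (inner h₁ i j) (permComp h₁ i σ τ) ρ =
      permComp h₄ i σ (permComp h₃ j τ ρ) := by
  refine Equiv.ext fun x => ?_
  rcases inner_or_outer h₂ (inner h₁ i j) x with ⟨s, rfl⟩ | ⟨⟨y, hy⟩, rfl⟩
  · rw [permComp_inner, inner_inner h₁ h₂ h₃ h₄, permComp_inner, permComp_inner, permComp_inner]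
    exact inner_inner h₁ h₂ h₃ h₄ _ _ _
  · rw [permComp_outer]
    rcases inner_or_outer h₁ i y with ⟨t, rfl⟩ | ⟨⟨l, hl⟩, rfl⟩
    · have ht : t ≠ j := fun e => hy (by rw [e])
      conv_rhs => rw [outer_inner_inner h₁ h₂ h₃ h₄ i j t ht, permComp_inner, permComp_outer]
      exact (outer_congr h₂ (permComp_inner ..) (permComp_inner ..) _).trans
        (outer_inner_inner h₁ h₂ h₃ h₄ _ _ _ (fun e => ht (τ.injective e)) _)
    · conv_rhs => rw [outer_inner_outer h₁ h₂ h₄, permComp_outer]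
      exact (outer_congr h₂ (permComp_inner ..) (permComp_outer ..) _).trans
        (outer_inner_outer h₁ h₂ h₄ _ _ _ _ _)

end Sequential

section Parallel

variable (h₃ : a + c = ac + 1) (h₄ : ac + b = abc + 1) (i l : Fin a) (hil : l ≠ i)

theorem inner_outer (s : Fin c) (hs : inner h₃ l s ≠ outer h₃ l ⟨i, hil.symm⟩) :
    inner h₂ (outer h₁ i ⟨l, hil⟩) s =
      outer h₄ (outer h₃ l ⟨i, hil.symm⟩) ⟨inner h₃ l s, hs⟩ := by
  have : (l : ℕ) ≠ i := fun e => hil (Fin.ext e)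
  ext
  simp only [inner_val, outer_val]
  split_ifs <;> omega

theorem outer_outer (m : Fin a) (hmi : m ≠ i) (hml : m ≠ l)
    (hm : outer h₁ i ⟨m, hmi⟩ ≠ outer h₁ i ⟨l, hil⟩)
    (hm' : outer h₃ l ⟨m, hml⟩ ≠ outer h₃ l ⟨i, hil.symm⟩) :
    outer h₂ (outer h₁ i ⟨l, hil⟩) ⟨outer h₁ i ⟨m, hmi⟩, hm⟩ =
      outer h₄ (outer h₃ l ⟨i, hil.symm⟩) ⟨outer h₃ l ⟨m, hml⟩, hm'⟩ := by
  have : (l : ℕ) ≠ i := fun e => hil (Fin.ext e)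
  have : (m : ℕ) ≠ i := fun e => hmi (Fin.ext e)
  have : (m : ℕ) ≠ l := fun e => hml (Fin.ext e)
  ext
  simp only [outer_val]
  split_ifs <;> omega

/-- The cases are the block at `l`, the block at `i`, and the remaining old inputs. The second is
the first with the roles of `i` and `l` exchanged, hence the reversed use of `inner_outer`. -/
theorem permComp_parallel (σ : Equiv.Perm (Fin a)) (τ : Equiv.Perm (Fin b))
    (ρ : Equiv.Perm (Fin c)) :
    permComp h₂ (outer h₁ i ⟨l, hil⟩) (permComp h₁ i σ τ) ρ =
      permComp h₄ (outer h₃ l ⟨i, hil.symm⟩) (permComp h₃ l σ ρ) τ := by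
  have hσ : σ l ≠ σ i := fun e => hil (σ.injective e)
  refine Equiv.ext fun x => ?_
  rcases inner_or_outer h₂ (outer h₁ i ⟨l, hil⟩) x with ⟨s, rfl⟩ | ⟨⟨y, hy⟩, rfl⟩
  · rw [permComp_inner, inner_outer h₁ h₂ h₃ h₄ i l hil s (inner_ne_outer _ _ _ _),
      permComp_outer, permComp_outer]
    exact (inner_outer h₁ h₂ h₃ h₄ _ _ hσ _ (inner_ne_outer _ _ _ _)).trans
      (outer_congr h₄ (permComp_outer h₃ l σ ρ ⟨i, hil.symm⟩) (permComp_inner h₃ l σ ρ s) _).symm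
  · rw [permComp_outer]
    rcases inner_or_outer h₁ i y with ⟨t, rfl⟩ | ⟨⟨m, hmi⟩, rfl⟩
    · conv_rhs =>
        rw [← inner_outer h₃ h₄ h₁ h₂ l i hil.symm t hy, permComp_inner, permComp_outer]
      exact (outer_congr h₂ (permComp_outer ..) (permComp_inner ..) _).trans
        (inner_outer h₃ h₄ h₁ h₂ _ _ hσ.symm _ _).symm
    · have hml : m ≠ l := fun e => hy (by subst e; rfl)
      conv_rhs => rw [outer_outer h₁ h₂ h₃ h₄ i l hil m hmi hml hy
        (fun e => hmi (congrArg Subtype.val (outer_injective _ _ e))), permComp_outer]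
      exact ((outer_congr h₂ (permComp_outer ..) (permComp_outer ..) _).trans
        (outer_outer h₁ h₂ h₃ h₄ _ _ hσ _ (fun e => hmi (σ.injective e))
          (fun e => hml (σ.injective e)) _
          (fun e => hmi (σ.injective (congrArg Subtype.val (outer_injective _ _ e)))))).trans
        (outer_congr h₄ (permComp_outer h₃ l σ ρ _) (permComp_outer h₃ l σ ρ ⟨m, hml⟩) _).symm

end Parallel

end Nested

end Perm

/-! ### Arities and degrees of iterated products -/

/-- The arity of a composite of `m` operations of arity `n`. -/
def treeArity (n : ℕ) : ℕ → ℕ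
  | 0 => 1
  | m + 1 => treeArity n m + (n - 1)

/-- The degree of a composite of `m` operations of degree `d`. -/
def treeDegree (d : ℤ) : ℕ → ℤ
  | 0 => 0
  | m + 1 => treeDegree d m + d

theorem treeArity_eq (n m : ℕ) : treeArity n m = m * (n - 1) + 1 := by
  induction m with
  | zero => simp [treeArity]
  | succ m ih => rw [treeArity, ih]; ring

theorem treeDegree_eq (d : ℤ) (m : ℕ) : treeDegree d m = m * d := by
  induction m with
  | zero => simp [treeDegree]
  | succ m ih => rw [treeDegree, ih]; push_cast; ring

theorem treeDegree_succ (d : ℤ) (m : ℕ) : treeDegree d m + d = treeDegree d (m + 1) := rfl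

theorem treeArity_succ {n : ℕ} (hn : 2 ≤ n) (m : ℕ) :
    treeArity n m + n = treeArity n (m + 1) + 1 := by
  simp only [treeArity]; omega

theorem treeArity_pos (n m : ℕ) : 0 < treeArity n m := by
  rw [treeArity_eq]; omega

theorem treeArity_add (n m l : ℕ) : treeArity n m + treeArity n l = treeArity n (m + l) + 1 := by
  simp only [treeArity_eq]; ring

theorem treeDegree_add (d : ℤ) (m l : ℕ) :
    treeDegree d m + treeDegree d l = treeDegree d (m + l) := by
  simp only [treeDegree_eq]; push_cast; ring

/-- With n - 1 > 0 the arity determines the number of copies of μ, and therefore also the degree. -/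
theorem treeArity_injective {n : ℕ} (hn : 2 ≤ n) : Function.Injective (treeArity n) := by
  intro m l h
  simp only [treeArity_eq, Nat.add_right_cancel_iff] at h
  exact Nat.eq_of_mul_eq_mul_right (by omega) h

/-! ### The model

The arities and degrees in which `tAss^n_d` is non-zero carry a copy of the regular representation,
and every composition of basis elements that lands there is a basis element. -/

/-- The arities and degrees of the non-zero components of `tAss^n_d`. -/
def Admissible (n : ℕ) (d : ℤ) (a : ℕ) (p : ℤ) : Prop :=
  ∃ m : ℕ, treeArity n m = a ∧ treeDegree d m = p ∧ (Even d ∨ m ≤ 2)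

section Admissible

variable {n : ℕ} {d : ℤ} (hn : 2 ≤ n) {a b c ab abc : ℕ} {p q r pq pqr : ℤ}

include hn in
-- A partial composite contains no more copies of μ than the full one, so it inherits the cutoff m ≤
-- 2. Thus truncation never kills an intermediate composite on the way to a surviving one.
theorem Admissible.of_comp (ha : Admissible n d a p) (hb : Admissible n d b q)
    (hc : Admissible n d c r) (habc : Admissible n d abc pqr) (h₁ : a + b = ab + 1)
    (e₁ : p + q = pq) (h₂ : ab + c = abc + 1) : Admissible n d ab pq := by
  obtain ⟨ma, rfl, rfl, -⟩ := ha
  obtain ⟨mb, rfl, rfl, -⟩ := hb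
  obtain ⟨mc, rfl, rfl, -⟩ := hc
  obtain ⟨m, rfl, rfl, hm⟩ := habc
  rw [treeArity_add, Nat.add_right_cancel_iff] at h₁
  rw [treeDegree_add] at e₁
  subst h₁ e₁
  rw [treeArity_add, Nat.add_right_cancel_iff] at h₂
  have := treeArity_injective hn h₂
  exact ⟨_, rfl, rfl, hm.imp_right fun _ => by omega⟩

include hn in
-- An operation with two inputs contains at least one copy of μ. Under the cutoff m ≤ 2 this leaves
-- at most one copy for the two operations plugged into it, so one of them has degree 0.
theorem Admissible.koszulSign_eq_one {k : Type u} [Field k] (ha : Admissible n d a p)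
    (hb : Admissible n d b q) (hc : Admissible n d c r) (habc : Admissible n d abc pqr)
    (h₁ : a + b = ab + 1) (h₂ : ab + c = abc + 1) (h : 2 ≤ a) : koszulSign k q r = 1 := by
  obtain ⟨ma, rfl, rfl, -⟩ := ha
  obtain ⟨mb, rfl, rfl, -⟩ := hb
  obtain ⟨mc, rfl, rfl, -⟩ := hc
  obtain ⟨m, rfl, rfl, hm⟩ := habc
  rw [treeArity_add, Nat.add_right_cancel_iff] at h₁
  subst h₁
  rw [treeArity_add, Nat.add_right_cancel_iff] at h₂
  have hm' := treeArity_injective hn h₂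
  have hma : 1 ≤ ma := Nat.pos_of_ne_zero fun e => by
    subst e
    simp [treeArity] at h
  have : Even (treeDegree d mb * treeDegree d mc) := by
    simp only [treeDegree_eq]
    rcases hm with hd | hm
    · exact (hd.mul_left _).mul_right _
    · obtain rfl | rfl : mb = 0 ∨ mc = 0 := by omega
      · simp
      · simp
  simp [koszulSign, Int.negOnePow_even _ this]

end Admissible

section Model

variable (k : Type u) [Field k] (n : ℕ) (d : ℤ)

/-- The components of the model. -/
abbrev ModelObj (a : ℕ) (p : ℤ) : Type u := {_σ : Equiv.Perm (Fin a) // Admissible n d a p} →₀ k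

variable {k n d}

theorem ModelObj.subsingleton {a : ℕ} {p : ℤ} (h : ¬ Admissible n d a p) :
    Subsingleton (ModelObj k n d a p) :=
  haveI : IsEmpty {_σ : Equiv.Perm (Fin a) // Admissible n d a p} := ⟨fun σ => h σ.2⟩
  inferInstance

open Classical in
/-- Partial compositions in the model. -/
noncomputable def modelComp {a b c : ℕ} {p q r : ℤ} (h : a + b = c + 1) (i : Fin a) :
    ModelObj k n d a p →ₗ[k] ModelObj k n d b q →ₗ[k] ModelObj k n d c r :=
  Finsupp.linearCombination k fun σ => Finsupp.linearCombination k fun τ =>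
    if hv : Admissible n d c r then Finsupp.single ⟨permComp h i σ.1 τ.1, hv⟩ 1 else 0

theorem modelComp_single {a b c : ℕ} {p q r : ℤ} (h : a + b = c + 1) (i : Fin a)
    (hv : Admissible n d c r) (σ : {_σ : Equiv.Perm (Fin a) // Admissible n d a p})
    (τ : {_σ : Equiv.Perm (Fin b) // Admissible n d b q}) (s t : k) :
    modelComp h i (Finsupp.single σ s) (Finsupp.single τ t) =
      Finsupp.single (⟨permComp h i σ.1 τ.1, hv⟩ :
        {_σ : Equiv.Perm (Fin c) // Admissible n d c r}) (s * t) := by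
  simp [modelComp, hv]

variable (k d) in
/-- The model of `tAss^n_d`. -/
noncomputable def model (hn : 2 ≤ n) : GradedOperad.{u, u} k where
  obj := ModelObj k n d
  act σ := Finsupp.lmapDomain k k fun τ => ⟨τ.1 * σ, τ.2⟩
  act_one x := by
    simp only [Finsupp.lmapDomain_apply, mul_one]
    exact Finsupp.mapDomain_id
  act_mul σ τ x := by
    simp only [Finsupp.lmapDomain_apply]
    rw [← Finsupp.mapDomain_comp]
    simp [Function.comp_def, mul_assoc]
  one := Finsupp.single ⟨1, 0, rfl, rfl, Or.inr (by omega)⟩ 1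
  comp h _ i := modelComp h i
  one_comp h hp x := by
    induction x using Finsupp.induction_linear with
    | zero => simp
    | add x y hx hy => rw [map_add, hx, hy]
    | single σ s => rw [modelComp_single h 0 σ.2]; simp [permComp_one_left]
  comp_one h hp i x := by
    induction x using Finsupp.induction_linear with
    | zero => simp
    | add x y hx hy => rw [LinearMap.map_add₂, hx, hy]
    | single σ s => rw [modelComp_single h i σ.2]; simp [permComp_one_right]
  comp_assoc {a b c ab bc abc p q r pq qr pqr} h₁ e₁ h₂ e₂ h₃ e₃ h₄ e₄ i j x y z := by
    by_cases hv : Admissible n d abc pqr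
    swap
    · exact (ModelObj.subsingleton hv).elim _ _
    induction x using Finsupp.induction_linear with
    | zero => simp
    | add x x' hx hx' => simp only [LinearMap.map_add₂, hx, hx']
    | single σ s =>
      induction y using Finsupp.induction_linear with
      | zero => simp
      | add y y' hy hy' => simp only [map_add, LinearMap.add_apply, hy, hy']
      | single τ t =>
        induction z using Finsupp.induction_linear with
        | zero => simp
        | add z z' hz hz' => simp only [map_add, hz, hz']
        | single ρ u =>
          rw [modelComp_single h₁ i (σ.2.of_comp hn τ.2 ρ.2 hv h₁ e₁ h₂),
            modelComp_single h₃ j (τ.2.of_comp hn ρ.2 σ.2 hv h₃ e₃ (by omega)),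
            modelComp_single h₂ _ hv, modelComp_single h₄ _ hv, mul_assoc]
          congr 2
          exact permComp_assoc h₁ h₂ h₃ h₄ i j _ _ _
  comp_parallel {a b c ab ac abc p q r pq pr pqr} h₁ e₁ h₂ e₂ h₃ e₃ h₄ e₄ i l hil x y z := by
    by_cases hv : Admissible n d abc pqr
    swap
    · exact (ModelObj.subsingleton hv).elim _ _
    induction x using Finsupp.induction_linear with
    | zero => simp
    | add x x' hx hx' => simp only [LinearMap.map_add₂, hx, hx', smul_add]
    | single σ s =>
      induction y using Finsupp.induction_linear with
      | zero => simp
      | add y y' hy hy' => simp only [map_add, LinearMap.add_apply, hy, hy', smul_add]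
      | single τ t =>
        induction z using Finsupp.induction_linear with
        | zero => simp
        | add z z' hz hz' => simp only [map_add, LinearMap.add_apply, hz, hz', smul_add]
        | single ρ u =>
          have : (l : ℕ) ≠ i := fun e => hil (Fin.ext e)
          -- The distinct inputs `i` and `l` force the arity of the outer operation to be at least
          -- 2.
          rw [σ.2.koszulSign_eq_one hn τ.2 ρ.2 hv h₁ h₂ (by omega), one_smul,
            modelComp_single h₁ i (σ.2.of_comp hn τ.2 ρ.2 hv h₁ e₁ h₂),
            modelComp_single h₃ l (σ.2.of_comp hn ρ.2 τ.2 hv h₃ e₃ h₄),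
            modelComp_single h₂ _ hv, modelComp_single h₄ _ hv, mul_right_comm]
          congr 2
          exact permComp_parallel h₁ h₂ h₃ h₄ i l hil _ _ _
  comp_act {a b c p q r} h hp i σ τ x y := by
    by_cases hv : Admissible n d c r
    swap
    · exact (ModelObj.subsingleton hv).elim _ _
    induction x using Finsupp.induction_linear with
    | zero => simp
    | add x x' hx hx' => simp only [map_add, LinearMap.add_apply, hx, hx']
    | single σ' s =>
      induction y using Finsupp.induction_linear with
      | zero => simp
      | add y y' hy hy' => simp only [map_add, hy, hy']
      | single τ' t =>
        simp only [Finsupp.lmapDomain_apply, Finsupp.mapDomain_single,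
          modelComp_single h _ hv, permComp_mul]

end Model

/-! ### Iterated products in a totally associative operad -/

section Power

variable {k : Type u} [Field k] (P : GradedOperad.{u, v} k) {n : ℕ} {d : ℤ} (hn : 2 ≤ n)
  (μ : P.obj n d)

/-- The `m`-fold iterate of `μ`, plugging always into the first input. -/
def power : ∀ m : ℕ, P.obj (treeArity n m) (treeDegree d m)
  | 0 => P.one
  | m + 1 => P.comp (treeArity_succ hn m) (treeDegree_succ d m) ⟨0, treeArity_pos n m⟩ (power m) μ

theorem power_succ {m : ℕ} (h : treeArity n m + n = treeArity n (m + 1) + 1)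
    (hp : treeDegree d m + d = treeDegree d (m + 1)) :
    power P hn μ (m + 1) = P.comp h hp ⟨0, treeArity_pos n m⟩ (power P hn μ m) μ := rfl

variable {P μ} (hμ : ∀ {c : ℕ} {r : ℤ} (h : n + n = c + 1) (hp : d + d = r) (i j : Fin n),
  P.comp h hp i μ μ = P.comp h hp j μ μ)

include hμ in
-- Reassociating turns both sides into x ∘_i (μ ∘ μ), where the relation applies.
theorem comp_comp_mu {a b c : ℕ} {p q r : ℤ} (h₁ : a + n = b + 1) (e₁ : p + d = q)
    (h₂ : b + n = c + 1) (e₂ : q + d = r) (x : P.obj a p) (i : Fin a) (j j' : Fin n) :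
    P.comp h₂ e₂ (inner h₁ i j) (P.comp h₁ e₁ i x μ) μ =
      P.comp h₂ e₂ (inner h₁ i j') (P.comp h₁ e₁ i x μ) μ := by
  have h₃ : n + n = (2 * n - 1) + 1 := by have := j.pos; omega
  rw [P.comp_assoc h₁ e₁ h₂ e₂ h₃ rfl (by omega) (by omega),
    P.comp_assoc h₁ e₁ h₂ e₂ h₃ rfl (by omega) (by omega), hμ h₃ rfl j j']

include hμ in
-- The first n inputs of an iterate are those of the copy of μ inserted last, so they are all
-- interchangeable with input 0.
theorem power_succ_comp_mu {m : ℕ} (h : treeArity n (m + 1) + n = treeArity n (m + 2) + 1)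
    (hp : treeDegree d (m + 1) + d = treeDegree d (m + 2)) (i : Fin (treeArity n (m + 1)))
    (hi : (i : ℕ) < n) : P.comp h hp i (power P hn μ (m + 1)) μ = power P hn μ (m + 2) := by
  have h₁ : treeArity n m + n = treeArity n (m + 1) + 1 := treeArity_succ hn m
  have e : i = inner h₁ ⟨0, treeArity_pos n m⟩ ⟨i, hi⟩ := by ext; simp [inner]
  have e' : (⟨0, treeArity_pos n (m + 1)⟩ : Fin (treeArity n (m + 1))) =
      inner h₁ ⟨0, treeArity_pos n m⟩ ⟨0, by omega⟩ := by ext; simp [inner]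
  rw [e, power_succ P hn μ h hp, e', power_succ P hn μ h₁ (treeDegree_succ d m)]
  exact comp_comp_mu hμ h₁ rfl h hp _ _ _ _

include hμ in
-- An input beyond the first n comes from an input of the previous iterate. Exchanging the two
-- insertions costs a Koszul sign and reduces to that iterate. The scalar is left unspecified, since
-- only spanning is at stake.
theorem exists_power_comp_mu (m : ℕ) (h : treeArity n m + n = treeArity n (m + 1) + 1)
    (hp : treeDegree d m + d = treeDegree d (m + 1)) (i : Fin (treeArity n m)) :
    ∃ s : k, P.comp h hp i (power P hn μ m) μ = s • power P hn μ (m + 1) := by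
  induction m with
  | zero =>
    obtain rfl : i = ⟨0, treeArity_pos n 0⟩ :=
      Fin.ext (Nat.lt_one_iff.mp (i.2 : (i : ℕ) < 1))
    exact ⟨1, (one_smul _ _).symm⟩
  | succ m ih =>
    by_cases hi : (i : ℕ) < n
    · exact ⟨1, by rw [one_smul, power_succ_comp_mu hn hμ h hp i hi]⟩
    · have h₁ : treeArity n m + n = treeArity n (m + 1) + 1 := treeArity_succ hn m
      have hin := i.2
      -- The last insertion, at input 0, shifted the later inputs by n - 1; this undoes the shift.
      let l : Fin (treeArity n m) := ⟨i + 1 - n, by omega⟩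
      have hl : l ≠ ⟨0, treeArity_pos n m⟩ := by
        rw [Ne, Fin.ext_iff]; simp only [l]; omega
      have e : i = outer h₁ ⟨0, treeArity_pos n m⟩ ⟨l, hl⟩ := by
        ext
        rw [outer_val]
        simp only [l, not_lt_zero, if_false]
        omega
      obtain ⟨s, hs⟩ := ih h₁ (treeDegree_succ d m) l
      have e' : (⟨0, treeArity_pos n (m + 1)⟩ : Fin (treeArity n (m + 1))) =
          outer h₁ l ⟨⟨0, treeArity_pos n m⟩, hl.symm⟩ := by
        ext
        rw [outer_val, if_pos]
        simp only [l]; omega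
      refine ⟨koszulSign k d d * s, ?_⟩
      rw [e, power_succ P hn μ h₁ (treeDegree_succ d m),
        P.comp_parallel h₁ (treeDegree_succ d m) h hp h₁ (treeDegree_succ d m) h hp _ l hl, hs,
        map_smul, LinearMap.smul_apply, mul_smul, ← e', ← power_succ P hn μ h hp]

include hμ in
-- Peel copies of μ off the right factor: by sequential associativity each becomes an insertion of μ
-- into an iterate.
theorem exists_power_comp_power (m l : ℕ)
    (h : treeArity n m + treeArity n l = treeArity n (m + l) + 1)
    (hp : treeDegree d m + treeDegree d l = treeDegree d (m + l)) (i : Fin (treeArity n m)) :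
    ∃ s : k, P.comp h hp i (power P hn μ m) (power P hn μ l) = s • power P hn μ (m + l) := by
  induction l with
  | zero => exact ⟨1, by rw [one_smul]; exact P.comp_one _ _ i _⟩
  | succ l ih =>
    have h₀ : treeArity n l + n = treeArity n (l + 1) + 1 := treeArity_succ hn l
    have h₁ := treeArity_add n m l
    have e₁ := treeDegree_add d m l
    have h₂ : treeArity n (m + l) + n = treeArity n (m + (l + 1)) + 1 :=
      treeArity_succ hn (m + l)
    obtain ⟨s, hs⟩ := ih h₁ e₁
    obtain ⟨t, ht⟩ := exists_power_comp_mu hn hμ (m + l) h₂ rfl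
      (inner h₁ i ⟨0, treeArity_pos n l⟩)
    refine ⟨s * t, ?_⟩
    have e₂ : treeDegree d (m + l) + d = treeDegree d (m + (l + 1)) := rfl
    rw [power_succ P hn μ h₀ (treeDegree_succ d l), ← P.comp_assoc h₁ e₁ h₂ e₂, hs, map_smul,
      LinearMap.smul_apply, ht, smul_smul]
    rfl

include hμ in
/-- In odd degree the two orders of parallel composition cancel each other. -/
theorem power_three_eq_zero [CharZero k] (hd : Odd d) : power P hn μ 3 = 0 := by
  have h₁ : treeArity n 1 + n = treeArity n 2 + 1 := treeArity_succ hn 1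
  have h₂ : treeArity n 2 + n = treeArity n 3 + 1 := treeArity_succ hn 2
  have h1 : treeArity n 1 = n := by simp only [treeArity]; omega
  have e₁ : treeDegree d 1 + d = treeDegree d 2 := rfl
  have e₂ : treeDegree d 2 + d = treeDegree d 3 := rfl
  let o : Fin (treeArity n 1) := ⟨0, treeArity_pos n 1⟩
  let l : Fin (treeArity n 1) := ⟨1, by omega⟩
  have hl : l ≠ o := by simp [l, o]
  have two : ∀ i : Fin (treeArity n 1), P.comp h₁ e₁ i (power P hn μ 1) μ = power P hn μ 2 :=
    fun i => power_succ_comp_mu hn hμ h₁ e₁ i (by have := i.2; omega)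
  have three : ∀ i : Fin (treeArity n 2), (i : ℕ) < n →
      P.comp h₂ e₂ i (power P hn μ 2) μ = power P hn μ 3 :=
    fun i hi => power_succ_comp_mu hn hμ h₂ e₂ i hi
  -- Inputs 0 and 1 of μ are filled in both orders: (μ ∘_0 μ) ∘_n μ = -(μ ∘_1 μ) ∘_0 μ. Position n
  -- is also the last input of the inner copy in μ ∘_1 μ = μ ∘_0 μ, so `hseq` moves it to position
  -- 1, where the composite is again μ^3.
  have hpar := P.comp_parallel h₁ e₁ h₂ e₂ h₁ e₁ h₂ e₂ o l hl (power P hn μ 1) μ μ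
  have hseq := comp_comp_mu hμ h₁ e₁ h₂ e₂ (power P hn μ 1) l ⟨n - 1, by omega⟩ ⟨0, by omega⟩
  have e : outer h₁ o ⟨l, hl⟩ = inner h₁ l ⟨n - 1, by omega⟩ := by
    ext
    simp only [outer_val, inner_val, l, o, not_lt_zero, if_false]
    omega
  rw [two, three (inner h₁ l ⟨0, _⟩) (by simp only [inner_val, l]; omega)] at hseq
  rw [two, two, e, hseq, three _ (by simp only [outer_val, l, o]; simp; omega)] at hpar
  have hs : koszulSign k d d = -1 := by
    simp [koszulSign, Int.negOnePow_odd _ (hd.mul hd)]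
  rw [hs, neg_one_smul] at hpar
  rw [eq_neg_iff_add_eq_zero, ← two_smul k] at hpar
  exact (smul_eq_zero.mp hpar).resolve_left two_ne_zero

include hμ in
theorem power_eq_zero [CharZero k] (hd : Odd d) {m : ℕ} (hm : 3 ≤ m) : power P hn μ m = 0 := by
  induction m, hm using Nat.le_induction with
  | base => exact power_three_eq_zero hn hμ hd
  | succ m _ ih => rw [power, ih, LinearMap.map_zero₂]

variable (P μ) in
/-- The translates of the iterated products. -/
inductive IsMonomial : ∀ {a : ℕ} {p : ℤ}, P.obj a p → Prop
  | act_power (m : ℕ) (σ : Equiv.Perm (Fin (treeArity n m))) :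
      IsMonomial (P.act σ (power P hn μ m))

variable (P μ) in
/-- The span of the translates of the iterated products. -/
def monomialSpan (a : ℕ) (p : ℤ) : Submodule k (P.obj a p) :=
  Submodule.span k {x | IsMonomial P hn μ x}

theorem one_mem_monomialSpan : P.one ∈ monomialSpan P hn μ 1 0 :=
  Submodule.subset_span <| by
    rw [← P.act_one P.one]
    exact IsMonomial.act_power (P := P) (hn := hn) (μ := μ) 0 1

theorem mu_mem_monomialSpan : μ ∈ monomialSpan P hn μ n d := by
  -- The arity of the first iterate is 1 + (n - 1), not literally n, so arity and degree are kept
  -- variable until they can be substituted.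
  have key : ∀ {c : ℕ} {r : ℤ} (h : 1 + n = c + 1) (hp : 0 + d = r),
      P.comp h hp 0 P.one μ ∈ monomialSpan P hn μ c r := by
    intro c r h hp
    obtain rfl : c = treeArity n 1 := by simp only [treeArity]; omega
    subst hp
    refine Submodule.subset_span ?_
    rw [← P.act_one (P.comp h rfl 0 P.one μ)]
    exact IsMonomial.act_power (P := P) (hn := hn) (μ := μ) 1 1
  have := key (add_comm 1 n) (zero_add d)
  rwa [P.one_comp] at this

theorem act_mem_monomialSpan {a : ℕ} {p : ℤ} (σ : Equiv.Perm (Fin a)) (x : P.obj a p)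
    (hx : x ∈ monomialSpan P hn μ a p) : P.act σ x ∈ monomialSpan P hn μ a p := by
  induction hx using Submodule.span_induction with
  | mem x hx =>
    obtain ⟨m, τ⟩ := hx
    rw [← P.act_mul]
    exact Submodule.subset_span (IsMonomial.act_power m _)
  | zero => rw [map_zero]; exact Submodule.zero_mem _
  | add x y _ _ hx hy => rw [map_add]; exact Submodule.add_mem _ hx hy
  | smul s x _ hx => rw [map_smul]; exact Submodule.smul_mem _ s hx

include hμ in
-- Equivariance pulls the permutations out of a composite of translates, leaving a composite of two
-- iterates.
theorem comp_mem_monomialSpan {a b c : ℕ} {p q r : ℤ} (h : a + b = c + 1) (hp : p + q = r)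
    (i : Fin a) (x : P.obj a p) (y : P.obj b q) (hx : x ∈ monomialSpan P hn μ a p)
    (hy : y ∈ monomialSpan P hn μ b q) : P.comp h hp i x y ∈ monomialSpan P hn μ c r := by
  induction hx, hy using Submodule.span_induction₂ with
  | mem_mem x y hx hy =>
    obtain ⟨m, σ⟩ := hx
    obtain ⟨l, τ⟩ := hy
    obtain rfl : c = treeArity n (m + l) := by rw [treeArity_add] at h; omega
    obtain rfl : treeDegree d (m + l) = r := by rw [← treeDegree_add, hp]
    obtain ⟨s, hs⟩ := exists_power_comp_power hn hμ m l h hp (σ i)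
    rw [P.comp_act, hs, map_smul]
    exact Submodule.smul_mem _ s (Submodule.subset_span (IsMonomial.act_power _ _))
  | zero_left y _ => rw [LinearMap.map_zero₂]; exact Submodule.zero_mem _
  | zero_right x _ => rw [map_zero]; exact Submodule.zero_mem _
  | add_left x x' y _ _ _ hx hx' => rw [LinearMap.map_add₂]; exact Submodule.add_mem _ hx hx'
  | add_right x y y' _ _ _ hy hy' => rw [map_add]; exact Submodule.add_mem _ hy hy'
  | smul_left s x y _ _ hxy => rw [LinearMap.map_smul₂]; exact Submodule.smul_mem _ s hxy
  | smul_right s x y _ _ hxy => rw [map_smul]; exact Submodule.smul_mem _ s hxy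

theorem monomialSpan_eq_span_range (m : ℕ) :
    monomialSpan P hn μ (treeArity n m) (treeDegree d m) =
      Submodule.span k (Set.range fun σ => P.act σ (power P hn μ m)) := by
  -- Free indices allow case analysis on `IsMonomial`; injectivity of the arity then identifies the
  -- two exponents and the casts become trivial.
  have key : ∀ {a : ℕ} {p : ℤ} (x : P.obj a p), IsMonomial P hn μ x →
      ∀ (ha : a = treeArity n m) (hp : p = treeDegree d m),
        (ha ▸ hp ▸ x : P.obj (treeArity n m) (treeDegree d m)) ∈
          Set.range fun σ => P.act σ (power P hn μ m) := by
    rintro a p x ⟨l, σ⟩ ha hp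
    obtain rfl := treeArity_injective hn ha
    exact ⟨σ, rfl⟩
  refine congrArg _ (Set.Subset.antisymm (fun x hx => key x hx rfl rfl) ?_)
  rintro _ ⟨σ, rfl⟩
  exact IsMonomial.act_power m σ

theorem monomialSpan_eq_bot {a : ℕ} {p : ℤ}
    (h : ∀ m, treeArity n m = a → treeDegree d m ≠ p) : monomialSpan P hn μ a p = ⊥ := by
  refine Submodule.span_eq_bot.2 fun x hx => ?_
  obtain ⟨m, σ⟩ := hx
  exact absurd rfl (h m rfl)

end Power

/-! ### The components of `tAss` -/

section Components

variable (k : Type u) [Field k] {n : ℕ} (hn : 2 ≤ n) (d : ℤ)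

variable (n) in
/-- The image of `μ` in `tAss`. -/
noncomputable def tAssMu : (tAss k n d).obj n d := Submodule.Quotient.mk (mu k n d)

variable {k d} in
theorem tAssMu_comp {c : ℕ} {r : ℤ} (h : n + n = c + 1) (hp : d + d = r) (i j : Fin n) :
    (tAss k n d).comp h hp i (tAssMu k n d) (tAssMu k n d) =
      (tAss k n d).comp h hp j (tAssMu k n d) (tAssMu k n d) :=
  (Submodule.Quotient.eq _).2 (InIdeal.of ⟨h, hp, i, j, rfl⟩)

variable {k d} in
theorem monomialSpan_tAss (a : ℕ) (p : ℤ) :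
    monomialSpan (tAss k n d) hn (tAssMu k n d) a p = ⊤ := by
  let S : ∀ a p, Submodule k ((freeOperad (regularModule k n d)).obj a p) := fun a p =>
    (monomialSpan (tAss k n d) hn (tAssMu k n d) a p).comap
      (ideal (freeOperad (regularModule k n d)) (tAssRelators k n d) a p).mkQ
  have hgen : ∀ {a p} (e : (regularModule k n d).obj a p),
      freeGen (regularModule k n d) e ∈ S a p := by
    intro a p e
    induction e using Finsupp.induction_linear with
    | zero =>
      have : freeGen (regularModule k n d) (0 : (regularModule k n d).obj a p) = 0 := by
        rw [← zero_smul k (0 : (regularModule k n d).obj a p)]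
        exact (FreeObj.sound _ (Rel.gen_smul _ _)).trans
          (FreeObj.sound _ (Rel.zero_smul _))
      exact this ▸ (S a p).zero_mem
    | add e f he hf =>
      have : freeGen (regularModule k n d) (e + f) = freeGen _ e + freeGen _ f :=
        FreeObj.sound _ (Rel.gen_add _ _)
      exact this ▸ (S a p).add_mem he hf
    | single σ s =>
      obtain ⟨σ, rfl, rfl⟩ := σ
      -- A basis vector of the regular representation is a translate of the one at the identity, so
      -- its image is a multiple of a translate of μ.
      have : freeGen (regularModule k a p)
          (Finsupp.single (⟨σ, rfl, rfl⟩ : {_σ : Equiv.Perm (Fin a) // a = a ∧ p = p}) s) =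
          s • (freeOperad (regularModule k a p)).act σ (mu k a p) := by
        have e : (Finsupp.single (⟨σ, rfl, rfl⟩ : {_σ : Equiv.Perm (Fin a) // a = a ∧ p = p}) s) =
            s • (regularModule k a p).act σ (Finsupp.single
              (⟨1, rfl, rfl⟩ : {_σ : Equiv.Perm (Fin a) // a = a ∧ p = p}) (1 : k)) := by
          refine Eq.symm ((congrArg (s • ·) Finsupp.mapDomain_single).trans ?_)
          simp
        rw [e]
        exact (FreeObj.sound _ (Rel.gen_smul _ _)).trans
          (FreeObj.sound _ (Rel.smul_congr _ (Rel.gen_act _ _)))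
      rw [this]
      exact (S a p).smul_mem s (act_mem_monomialSpan hn σ _ (mu_mem_monomialSpan hn))
  refine (Submodule.eq_top_iff'.2 fun x => ?_)
  induction x using Submodule.Quotient.induction_on with | _ x
  exact freeOperad_mem_of_closed S hgen (one_mem_monomialSpan hn)
    (fun σ _ hx => act_mem_monomialSpan hn σ _ hx)
    (fun h hp i _ _ hx hy => comp_mem_monomialSpan hn tAssMu_comp h hp i _ _ hx hy) x

include hn in
variable {d} in
theorem admissible_generator {a : ℕ} {p : ℤ} (h : a = n ∧ p = d) : Admissible n d a p :=
  ⟨1, by simp only [treeArity]; omega, by simp [treeDegree, h.2], Or.inr (by omega)⟩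

/-- The morphism of `Σ`-modules that identifies the generators of `tAss` with basis elements of
the model. -/
noncomputable def genToModel (a : ℕ) (p : ℤ) :
    (regularModule k n d).obj a p →ₗ[k] (model k d hn).obj a p :=
  Finsupp.lmapDomain k k fun σ => ⟨σ.1, admissible_generator hn σ.2⟩

theorem genToModel_act (a : ℕ) (p : ℤ) (σ : Equiv.Perm (Fin a))
    (e : (regularModule k n d).obj a p) :
    genToModel k hn d a p ((regularModule k n d).act σ e) =
      (model k d hn).act σ (genToModel k hn d a p e) := by
  refine Eq.trans (b := Finsupp.mapDomain _ e) Finsupp.mapDomain_comp.symm ?_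
  exact Finsupp.mapDomain_comp
    (f := fun τ : {_σ : Equiv.Perm (Fin a) // a = n ∧ p = d} =>
      (⟨τ.1, admissible_generator hn τ.2⟩ : {_σ // Admissible n d a p}))
    (g := fun τ => (⟨τ.1 * σ, τ.2⟩ : {_σ // Admissible n d a p}))

theorem freeLift_mu :
    freeLift (model k d hn) (genToModel k hn d) (genToModel_act k hn d) n d (mu k n d) =
      (Finsupp.single ⟨1, admissible_generator hn ⟨rfl, rfl⟩⟩ 1 : ModelObj k n d n d) :=
  (freeLift_gen ..).trans Finsupp.mapDomain_single

/-- Composing identity permutations at any input gives the identity, so all μ ∘_i μ have the same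
image. It lies in the component m = 2, which survives for every d. -/
theorem genToModel_relators (a : ℕ) (p : ℤ) (x : (freeOperad (regularModule k n d)).obj a p)
    (hx : x ∈ tAssRelators k n d a p) :
    freeLift (model k d hn) (genToModel k hn d) (genToModel_act k hn d) a p x = 0 := by
  obtain ⟨h, hp, i, j, rfl⟩ := hx
  have hv : Admissible n d a p :=
    ⟨2, by simp only [treeArity]; omega, by simp [treeDegree, hp], Or.inr le_rfl⟩
  rw [map_sub, freeLift_comp, freeLift_comp, freeLift_mu]
  refine sub_eq_zero.2 ((modelComp_single h i hv _ _ _ _).trans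
    (Eq.trans ?_ (modelComp_single h j hv _ _ _ _).symm))
  simp only [permComp_one_one]

/-- The morphism from `tAss` to the model. -/
noncomputable def toModel (a : ℕ) (p : ℤ) :
    (tAss k n d).obj a p →ₗ[k] (model k d hn).obj a p :=
  quotLift (model k d hn) (genToModel k hn d) (genToModel_act k hn d) (tAssRelators k n d)
    (genToModel_relators k hn d) a p

variable {k d} in
theorem toModel_power (m : ℕ) (hm : Even d ∨ m ≤ 2) :
    toModel k hn d _ _ (power (tAss k n d) hn (tAssMu k n d) m) =
      (Finsupp.single ⟨1, m, rfl, rfl, hm⟩ 1 : ModelObj k n d _ _) := by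
  induction m with
  | zero => rfl
  | succ m ih =>
    have hmu : toModel k hn d n d (tAssMu k n d) =
        (Finsupp.single ⟨1, admissible_generator hn ⟨rfl, rfl⟩⟩ 1 : ModelObj k n d _ _) :=
      freeLift_mu k hn d
    rw [power, toModel]
    refine (quotLift_comp ..).trans ?_
    change modelComp _ _ (toModel k hn d _ _ _) (toModel k hn d n d _) = _
    rw [ih (hm.imp_right fun _ => by omega), hmu]
    refine (modelComp_single _ _ ⟨m + 1, rfl, rfl, hm⟩ _ _ _ _).trans ?_
    simp only [permComp_one_one, mul_one]

variable {k d} in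
-- Independence can be tested after mapping to the model, where the translates become distinct basis
-- vectors.
theorem linearIndependent_act_power (m : ℕ) (hm : Even d ∨ m ≤ 2) :
    LinearIndependent k fun σ : Equiv.Perm (Fin (treeArity n m)) =>
      (tAss k n d).act σ (power (tAss k n d) hn (tAssMu k n d) m) := by
  refine LinearIndependent.of_comp (toModel k hn d _ _) ?_
  have : (toModel k hn d _ _ ∘ fun σ : Equiv.Perm (Fin (treeArity n m)) =>
      (tAss k n d).act σ (power (tAss k n d) hn (tAssMu k n d) m)) =
      fun σ => (Finsupp.single ⟨σ, m, rfl, rfl, hm⟩ 1 : ModelObj k n d _ _) := by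
    funext σ
    refine (quotLift_act ..).trans ?_
    change (model k d hn).act σ (toModel k hn d _ _ _) = _
    rw [toModel_power hn m hm]
    refine Finsupp.mapDomain_single.trans ?_
    simp only [one_mul]
  rw [this]
  exact (Finsupp.linearIndependent_single_one k _).comp
    (fun σ : Equiv.Perm (Fin (treeArity n m)) =>
      (⟨σ, m, rfl, rfl, hm⟩ : {_σ : Equiv.Perm (Fin (treeArity n m)) //
        Admissible n d (treeArity n m) (treeDegree d m)}))
    fun σ τ e => congrArg Subtype.val e

variable {k d} in
theorem top_le_span_act_power (m : ℕ) :
    ⊤ ≤ Submodule.span k (Set.range fun σ : Equiv.Perm (Fin (treeArity n m)) =>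
      (tAss k n d).act σ (power (tAss k n d) hn (tAssMu k n d) m)) := by
  rw [← monomialSpan_eq_span_range, monomialSpan_tAss]

include hn in
theorem finrank_tAss (m : ℕ) (hm : Even d ∨ m ≤ 2) :
    Module.finrank k ((tAss k n d).obj (treeArity n m) (treeDegree d m)) =
      (treeArity n m).factorial := by
  rw [Module.finrank_eq_card_basis (Module.Basis.mk (linearIndependent_act_power hn m hm)
    (top_le_span_act_power hn m)), Fintype.card_perm, Fintype.card_fin]

include hn in
theorem subsingleton_tAss {a : ℕ} {p : ℤ} (h : ∀ m, treeArity n m = a → treeDegree d m ≠ p) :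
    Subsingleton ((tAss k n d).obj a p) := by
  rw [← Submodule.subsingleton_iff k, ← subsingleton_iff_bot_eq_top,
    ← monomialSpan_tAss hn, monomialSpan_eq_bot hn h]

include hn in
theorem subsingleton_tAss_of_odd [CharZero k] (hd : Odd d) {m : ℕ} (hm : 3 ≤ m) (p : ℤ) :
    Subsingleton ((tAss k n d).obj (treeArity n m) p) := by
  by_cases hp : treeDegree d m = p
  · subst hp
    have := top_le_span_act_power (k := k) (d := d) hn m
    simp only [power_eq_zero hn tAssMu_comp hd hm, map_zero, Set.range_const,
      Submodule.span_zero_singleton, top_le_iff] at this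
    rwa [← Submodule.subsingleton_iff k, ← subsingleton_iff_bot_eq_top]
  · refine subsingleton_tAss k hn d fun l hl => ?_
    rwa [treeArity_injective hn hl]

include hn in
theorem finiteTotalDim_tAss : FiniteTotalDim (tAss k n d) := by
  refine fun a => ⟨fun p => ?_, ?_⟩
  · by_cases h : ∃ m, treeArity n m = a ∧ treeDegree d m = p
    · obtain ⟨m, rfl, rfl⟩ := h
      exact ⟨top_le_iff.mp (top_le_span_act_power (k := k) hn m) ▸
        Submodule.fg_span (Set.finite_range _)⟩
    · push Not at h
      have := subsingleton_tAss k hn d h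
      infer_instance
  -- In each arity at most one degree is nonzero.
  · refine Set.Subsingleton.finite fun p hp q hq => ?_
    have key : ∀ p, Nontrivial ((tAss k n d).obj a p) →
        ∃ m, treeArity n m = a ∧ treeDegree d m = p := by
      intro p hp
      by_contra! h
      exact not_subsingleton_iff_nontrivial.2 hp (subsingleton_tAss k hn d h)
    obtain ⟨m, rfl, rfl⟩ := key p hp
    obtain ⟨l, hl, rfl⟩ := key q hq
    rw [treeArity_injective hn hl]

/-! ### The Poincaré series -/

include hn in
theorem eulerChar_tAss (m : ℕ) : eulerChar (tAss k n d) (treeArity n m) =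
    ((treeDegree d m).negOnePow : ℤˣ) *
      Module.finrank k ((tAss k n d).obj (treeArity n m) (treeDegree d m)) := by
  refine finsum_eq_single _ _ fun p hp => ?_
  have := subsingleton_tAss k hn d (a := treeArity n m) (p := p) fun l hl e =>
    hp (by rw [← e, treeArity_injective hn hl])
  simp [Module.finrank_zero_of_subsingleton]

include hn in
theorem coeff_poincareSeries_tAss (m : ℕ) (hm : Even d ∨ m ≤ 2) :
    (poincareSeries (tAss k n d)).coeff (treeArity n m) =
      (((treeDegree d m).negOnePow : ℤˣ) : ℤ) := by
  have hf : ((treeArity n m).factorial : ℚ) ≠ 0 := Nat.cast_ne_zero.2 (Nat.factorial_ne_zero _)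
  rw [poincareSeries, PowerSeries.coeff_mk, if_neg (treeArity_pos n m).ne',
    eulerChar_tAss k hn, finrank_tAss k hn d m hm]
  push_cast
  field_simp

include hn in
theorem coeff_poincareSeries_tAss_eq_zero {a : ℕ} (ha : ∀ m, treeArity n m ≠ a) :
    (poincareSeries (tAss k n d)).coeff a = 0 := by
  have : eulerChar (tAss k n d) a = 0 := by
    refine finsum_eq_zero_of_forall_eq_zero fun p => ?_
    have := subsingleton_tAss k hn d (p := p) fun m hm => absurd hm (ha m)
    simp [Module.finrank_zero_of_subsingleton]
  simp [poincareSeries, this]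

include hn in
theorem poincareSeries_tAss_of_even (hd : Even d) : poincareSeries (tAss k n d) =
    PowerSeries.X * (1 - PowerSeries.X ^ (n - 1))⁻¹ := by
  have hc : ∀ m, (poincareSeries (tAss k n d)).coeff (treeArity n m) = 1 := fun m => by
    rw [coeff_poincareSeries_tAss k hn d m (Or.inl hd), treeDegree_eq,
      Int.negOnePow_even _ (hd.mul_left _)]
    simp
  -- The constant term of the denominator is 1 because n - 1 > 0. After clearing it, consecutive
  -- nonzero coefficients cancel.
  rw [PowerSeries.eq_mul_inv_iff_mul_eq (by simp [show n - 1 ≠ 0 by omega])]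
  ext a
  rw [mul_sub, mul_one, map_sub, PowerSeries.coeff_mul_X_pow', PowerSeries.coeff_X]
  by_cases ha : ∃ m, treeArity n m = a
  · obtain ⟨m, rfl⟩ := ha
    rw [hc]
    cases m with
    | zero =>
      have h0 : treeArity n 0 = 1 := rfl
      rw [h0, if_pos rfl]
      -- The shifted coefficient occurs only for n = 2, where its index is 0, the arity of no
      -- iterate.
      split_ifs with h
      · rw [coeff_poincareSeries_tAss_eq_zero k hn d fun m hm => ?_, sub_zero]
        have := treeArity_pos n m
        omega
      · rw [sub_zero]
    | succ m =>
      have hpos := treeArity_pos n m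
      rw [treeArity, if_pos (by omega), Nat.add_sub_cancel, hc, if_neg (by omega), sub_self]
  · push Not at ha
    have h0 : a ≠ 1 := (ha 0).symm
    rw [coeff_poincareSeries_tAss_eq_zero k hn d ha, if_neg h0]
    split_ifs with h
    · rw [coeff_poincareSeries_tAss_eq_zero k hn d fun m hm => ha (m + 1) (by
        rw [treeArity, hm, Nat.sub_add_cancel h]), sub_zero]
    · rw [sub_zero]

include hn in
theorem poincareSeries_tAss_of_odd [CharZero k] (hd : Odd d) : poincareSeries (tAss k n d) =
    PowerSeries.X - PowerSeries.X ^ n + PowerSeries.X ^ (2 * n - 1) := by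
  ext a
  rw [map_add, map_sub, PowerSeries.coeff_X, PowerSeries.coeff_X_pow, PowerSeries.coeff_X_pow]
  by_cases ha : ∃ m, treeArity n m = a
  · obtain ⟨m, rfl⟩ := ha
    by_cases hm : m ≤ 2
    · rw [coeff_poincareSeries_tAss k hn d m (Or.inr hm)]
      interval_cases m
      · rw [if_pos (by rfl), if_neg (by simp only [treeArity]; omega),
          if_neg (by simp only [treeArity]; omega)]
        simp [treeDegree]
      · rw [if_neg (by simp only [treeArity]; omega), if_pos (by simp only [treeArity]; omega),
          if_neg (by simp only [treeArity]; omega)]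
        simp [treeDegree, Int.negOnePow_odd _ hd]
      · rw [if_neg (by simp only [treeArity]; omega), if_neg (by simp only [treeArity]; omega),
          if_pos (by simp only [treeArity]; omega)]
        simp [treeDegree, Int.negOnePow_even _ (hd.add_odd hd)]
    · have hlt : ∀ l, l ≤ 2 → treeArity n m ≠ treeArity n l := fun l hl e =>
        hm (treeArity_injective hn e ▸ hl)
      have h0 := hlt 0 (by omega)
      have h1 := hlt 1 (by omega)
      have h2 := hlt 2 le_rfl
      simp only [treeArity] at h0 h1 h2
      rw [if_neg h0, if_neg (by omega), if_neg (by omega)]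
      have := subsingleton_tAss_of_odd k hn d hd (m := m) (by omega) (treeDegree d m)
      simp [poincareSeries, eulerChar_tAss k hn d m, Module.finrank_zero_of_subsingleton]
  · push Not at ha
    have h0 := ha 0
    have h1 := ha 1
    have h2 := ha 2
    simp only [treeArity] at h0 h1 h2
    rw [coeff_poincareSeries_tAss_eq_zero k hn d ha, if_neg (by omega), if_neg (by omega),
      if_neg (by omega)]
    simp

end Components

end NAry

theorem lemmal {k : Type*} [Field k] [CharZero k] (n : ℕ) (hn : 2 ≤ n) (d : ℤ) :
    NAry.FiniteTotalDim (NAry.tAss k n d) ∧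
    (Even d → NAry.poincareSeries (NAry.tAss k n d) =
      PowerSeries.X * (1 - PowerSeries.X ^ (n - 1))⁻¹) ∧
    (Odd d → NAry.poincareSeries (NAry.tAss k n d) =
        PowerSeries.X - PowerSeries.X ^ n + PowerSeries.X ^ (2 * n - 1) ∧
      ∀ m : ℕ, 3 ≤ m → ∀ p : ℤ, Subsingleton ((NAry.tAss k n d).obj (m * (n - 1) + 1) p)) := by
  refine ⟨NAry.finiteTotalDim_tAss k hn d, NAry.poincareSeries_tAss_of_even k hn d,
    fun hd => ⟨NAry.poincareSeries_tAss_of_odd k hn d hd, fun m hm p => ?_⟩⟩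
  rw [← NAry.treeArity_eq]
  exact NAry.subsingleton_tAss_of_odd k hn d hd hm p
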